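/- Let $\mathbb{X}\subseteq\mathbb{R}^d$ carry the Euclidean metric, let $Q$ be the distribution of a pair $(X,Y)\in\mathbb{X}\times\{+1,-1\}$ with input marginal $Q_X$, and let $f^*(x)=\mathbb{E}[Y\mid X=x]$. Put $\|g\|_Q^2=\int g^2\,dQ_X$. Let $\{f_\theta:\mathbb{X}\to[-1,1]\mid\theta\in\Theta\}$ be a family of measurable functions with $\|f_{\theta_1}-f_{\theta_2}\|_Q\neq 0$ whenever $\theta_1\neq\theta_2$, and let $\theta^*\in\Theta$ satisfy $f_{\theta^*}=f^*$. Let $q<m$ be integers and let $(k_n)$ be a sequence of natural numbers. For sample size $n$, let $(X_i,Y_i)_{i=1}^n$ be i.i.d. from $Q$, let $U_{i,j}$ ($1\le i\le n$, $1\le j\le m-1$) be i.i.d. uniform on $[-1,1]$, and let $\pi$ be a uniformly random permutation of $\{1,\dots,m\}$, all independent. For $\theta\in\Theta$ put $Y_{i,0}(\theta)=Y_i$ and $Y_{i,j}(\theta)=\mathrm{sign}(f_\theta(X_i)+U_{i,j})$ for $1\le j\le m-1$, and for $0\le j\le m-1$ let $$f^{(j)}_{\theta,n}(x)=\frac1{k_n}\sum_{i=1}^n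 Y_{i,j}(\theta)\,\mathbb{I}\big(X_i\in N_n(x,k_n)\big),\qquad Z_n^{(j)}(\theta)=\frac1n\sum_{i=1}^n\big(f_\theta(X_i)-f^{(j)}_{\theta,n}(X_i)\big)^2,$$ where $N_n(x,k)$ is the set of the $k$ points of the sample $X_1,\dots,X_n$ closest to $x$ (ties, which have probability zero below, are broken by the index). Write $Z_n^{(j)}\prec_\pi Z_n^{(l)}$ if $Z_n^{(j)}<Z_n^{(l)}$, or $Z_n^{(j)}=Z_n^{(l)}$ and $\pi(j)<\pi(l)$, with the convention $\pi(0):=\pi(m)$. Let $$\Theta_n^{(2)}=\Big\{\theta\in\Theta\;\Big|\;1+\sum_{j=1}^{m-1}\mathbb{I}\big(Z_n^{(j)}(\theta)\prec_\pi Z_n^{(0)}(\theta)\big)\le q\Big\}.$$ Assume that $k_n/n\to0$ and that $k_n^2/n^{1+\delta}\to\infty$ for some $\delta>0$ as $n\to\infty$, and that $\mathbb{P}\big(\|X-X'\|_2\neq\|X-X''\|_2\big)=1$, where $X',X''$ are independent copies of $X$. Then for every $\theta\in\Theta$ with $\theta\neq\theta^*$ there is an $N_0$ such that for all $n\ge N_0$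 $$\mathbb{P}\big(\theta\notin\Theta_n^{(2)}\big)\;\ge\;1-C_2\,e^{-k_n^2\lambda_2/n},\qquad C_2=4+2(m-1),\quad \lambda_2=\frac{\kappa^4}{2\cdot 48^2},\quad \kappa=\|f_\theta-f^*\|_Q.$$ -/

import Mathlib

open MeasureTheory ProbabilityTheory Filter Topology

namespace KNNResampling

noncomputable section

/-- The discrete σ-algebra on the (finite) set of permutations of `m` objects. -/
instance permMeasurableSpace (m : ℕ) : MeasurableSpace (Equiv.Perm (Fin m)) := ⊤

/-- The uniform distribution on the interval `[-1, 1]`. -/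
def uniformPM : Measure ℝ := ProbabilityTheory.cond volume (Set.Icc (-1 : ℝ) 1)

/-- The uniform distribution on the symmetric group on `m` objects. -/
def uniformPerm (m : ℕ) : Measure (Equiv.Perm (Fin m)) :=
  (PMF.uniformOfFintype (Equiv.Perm (Fin m))).toMeasure

/-- The sign function with values in `{1, -1}`. The convention at `0` is immaterial below: it is
only ever used at `f x + u` with `u` drawn from a distribution without atoms. -/
def sgn (t : ℝ) : ℝ := if 0 ≤ t then 1 else -1

section Distribution

variable {E : Type*} [MeasurableSpace E]

/-- `f` is (a version of) the regression function `x ↦ 𝔼[Y | X = x]` of a distribution `Q`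
of the pair `(X, Y)`. -/
def IsRegressionFunction (Q : Measure (E × ℝ)) (f : E → ℝ) : Prop :=
  Measurable f ∧
    Q[fun z : E × ℝ => z.2 | MeasurableSpace.comap Prod.fst inferInstance]
      =ᵐ[Q] fun z : E × ℝ => f z.1

/-- The squared distance `‖f - g‖²_Q = ∫ (f x - g x)² dQ_X(x)`, where `Q_X` is the marginal
distribution of the inputs. -/
def sqDistQ (Q : Measure (E × ℝ)) (f g : E → ℝ) : ℝ :=
  ∫ x, (f x - g x) ^ 2 ∂Q.fst

/-- The distance `‖f - g‖_Q`. -/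
def distQ (Q : Measure (E × ℝ)) (f g : E → ℝ) : ℝ :=
  Real.sqrt (sqDistQ Q f g)

end Distribution

section Estimator

variable {E : Type*} [PseudoMetricSpace E] {n : ℕ}

/-- `x i` is strictly preferred to `x j` as a neighbour of `z`: it is closer to `z`, or equally
close with a smaller index. -/
def Closer (x : Fin n → E) (z : E) (i j : Fin n) : Prop :=
  dist (x i) z < dist (x j) z ∨ (dist (x i) z = dist (x j) z ∧ i < j)

open Classical in
/-- The indices of the `k` points of `x 1, …, x n` that are closest to `z`: those `i` to which fewer
than `k` sample points are preferred. -/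
def neighbors (k : ℕ) (x : Fin n → E) (z : E) : Finset (Fin n) :=
  {i | (Finset.univ.filter fun j => Closer x z j i).card < k}

/-- The `k`-nearest neighbours estimator
`z ↦ (1 / k) ∑ᵢ yᵢ 𝕀(xᵢ is among the k nearest neighbours of z)`. -/
def knnEstimate (k : ℕ) (x : Fin n → E) (y : Fin n → ℝ) (z : E) : ℝ :=
  (1 / (k : ℝ)) * ∑ i ∈ neighbors k x z, y i

end Estimator

section Ranking

variable {E : Type*} [PseudoMetricSpace E] {n m : ℕ} [NeZero m]

/-- The labels of the `j`-th dataset for the candidate regression function `g`: the original labels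
`y i` for `j = 0`, and the resampled labels `sign (g (x i) + u i j)` for `j = 1, …, m - 1`. -/
def labels (g : E → ℝ) (x : Fin n → E) (y : Fin n → ℝ)
    (u : Fin n → {j : Fin m // j ≠ 0} → ℝ) (j : Fin m) (i : Fin n) : ℝ :=
  if h : j = 0 then y i else sgn (g (x i) + u i ⟨j, h⟩)

/-- The reference variable `Z⁽ʲ⁾ = (1 / n) ∑ᵢ (g (xᵢ) - g⁽ʲ⁾(xᵢ))²`, where `g⁽ʲ⁾` is the
`k`-nearest neighbours estimate computed from the `j`-th dataset. -/
def refVar (k : ℕ) (g : E → ℝ) (x : Fin n → E) (y : Fin n → ℝ)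
    (u : Fin n → {j : Fin m // j ≠ 0} → ℝ) (j : Fin m) : ℝ :=
  (1 / (n : ℝ)) * ∑ i, (g (x i) - knnEstimate k x (labels g x y u j) (x i)) ^ 2

/-- The strict total order on the indices of the values `z 0, …, z (m - 1)`, with ties broken by the
permutation `p`. -/
def Prec (z : Fin m → ℝ) (p : Equiv.Perm (Fin m)) (j l : Fin m) : Prop :=
  z j < z l ∨ (z j = z l ∧ p j < p l)

open Classical in
/-- The rank `1 + ∑_{j = 1}^{m - 1} 𝕀(Z⁽⁰⁾ ≻ Z⁽ʲ⁾)` of the original dataset among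
the `m` datasets. -/
def rank (k : ℕ) (g : E → ℝ) (x : Fin n → E) (y : Fin n → ℝ)
    (u : Fin n → {j : Fin m // j ≠ 0} → ℝ) (p : Equiv.Perm (Fin m)) : ℕ :=
  1 + ∑ j ∈ Finset.univ.filter (fun j : Fin m => j ≠ 0),
    if Prec (refVar k g x y u) p j 0 then 1 else 0

/-- The nearest neighbours based confidence region: the parameters whose rank is at most `q`. -/
def confidenceRegion {Θ : Type*} (f : Θ → E → ℝ) (q k : ℕ) (x : Fin n → E) (y : Fin n → ℝ)
    (u : Fin n → {j : Fin m // j ≠ 0} → ℝ) (p : Equiv.Perm (Fin m)) : Set Θ :=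
  {θ | rank k (f θ) x y u p ≤ q}

end Ranking

/-- The joint law of the randomness of the method for sample size `n` and `m` datasets: an i.i.d.
sample of size `n` from `Q`, i.i.d. variables uniform on `[-1, 1]` indexed by `i = 1, …, n` and
`j = 1, …, m - 1`, and a uniformly distributed permutation, all independent. -/
def experimentLaw {E : Type*} [MeasurableSpace E] (Q : Measure (E × ℝ)) (n m : ℕ) [NeZero m] :
    Measure ((Fin n → E × ℝ) × (Fin n → {j : Fin m // j ≠ 0} → ℝ) × Equiv.Perm (Fin m)) :=
  (Measure.pi fun _ => Q).prod
    ((Measure.pi fun _ => Measure.pi fun _ => uniformPM).prod (uniformPerm m))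

end

end KNNResampling

/-! The labels resampled from `f θ` have regression function `f θ`, so the `k`-NN estimate built
from them is close to `f θ` and each `Z⁽ʲ⁾` with `j ≠ 0` tends to `0`. The original labels have
regression function `f θstar`, so the same estimator is close to `f θstar` and `Z⁽⁰⁾` stays bounded
away from `0` in terms of `s = κ²`. Once every `Z⁽ʲ⁾` is below `Z⁽⁰⁾` the rank equals `m > q`, and
`θ` is rejected.

Both halves rest on one exponential consistency statement, `exists_knnRisk_tail_le`: the mean
squared error of the estimate at the sample points exceeds a fixed `ε` with probability at most `4 n
exp (-c k)`. The error splits into noise and bias. The neighbour sets depend on the inputs only, so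
each noise average is a sum of `k` conditionally centred bounded terms; its moment generating
function is bounded by integrating out one label at a time, and a Chernoff and a union bound follow.
For the bias, the regression function is approximated in `L²` by a bounded continuous `g`. Stone's
lemma controls the smoothed approximation error. Smoothing changes `g` little because, outside a set
of small measure, finitely many small cells cover the space, and a cell with at least `k` sample
points confines the neighbours of its points; the remaining cells hold only `O(k) = o(n)` points.
Hoeffding's inequality controls the empirical means involved.

The rate `exp (-k² λ / n)` is then weak: `k² / n = (k / n) k = o(k)`, while `n ≤ k²` makes the
factor `n` harmless. Hence any rate `c > 0` suffices, whatever the value of `λ ≥ 0`. -/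

namespace KNNResampling

/-! ### Combinatorics of nearest neighbours -/

section Neighbors

variable {E : Type*} [PseudoMetricSpace E] {n : ℕ}

open Classical in
theorem mem_neighbors {k : ℕ} {x : Fin n → E} {z : E} {i : Fin n} :
    i ∈ neighbors k x z ↔ (Finset.univ.filter fun j => Closer x z j i).card < k := by
  simp [neighbors]

theorem Closer.trans {x : Fin n → E} {z : E} {a b c : Fin n} (hab : Closer x z a b)
    (hbc : Closer x z b c) : Closer x z a c := by
  unfold Closer at *
  rcases hab with h | ⟨h, h'⟩ <;> rcases hbc with g | ⟨g, g'⟩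
  · exact Or.inl (h.trans g)
  · exact Or.inl (g ▸ h)
  · exact Or.inl (h ▸ g)
  · exact Or.inr ⟨h.trans g, h'.trans g'⟩

theorem not_closer_self (x : Fin n → E) (z : E) (a : Fin n) : ¬ Closer x z a a := by
  simp [Closer]

theorem closer_or_closer_of_ne (x : Fin n → E) (z : E) {a b : Fin n} (h : a ≠ b) :
    Closer x z a b ∨ Closer x z b a := by
  unfold Closer
  rcases lt_trichotomy (dist (x a) z) (dist (x b) z) with h1 | h1 | h1
  · exact Or.inl (Or.inl h1)
  · rcases lt_or_gt_of_ne h with h2 | h2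
    · exact Or.inl (Or.inr ⟨h1, h2⟩)
    · exact Or.inr (Or.inr ⟨h1.symm, h2⟩)
  · exact Or.inr (Or.inl h1)

-- `Closer` is a strict total order on indices, so counting the predecessors of an index is a
-- bijection onto `0, …, n - 1`, and exactly `k` indices have fewer than `k` predecessors.
open Classical in
theorem card_neighbors {k : ℕ} (hk : k ≤ n) (x : Fin n → E) (z : E) :
    (neighbors k x z).card = k := by
  let r : Fin n → ℕ := fun i => (Finset.univ.filter fun j => Closer x z j i).card
  have hlt : ∀ a b, Closer x z a b → r a < r b := fun a b hab => by
    refine Finset.card_lt_card ⟨fun j hj => ?_, fun hsub => ?_⟩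
    · simp only [Finset.mem_filter, Finset.mem_univ, true_and] at hj ⊢
      exact hj.trans hab
    · have : a ∈ Finset.univ.filter fun j => Closer x z j a := hsub (by simpa using hab)
      exact not_closer_self x z a (by simpa using this)
  have hrn : ∀ i, r i < n := fun i => by
    have : r i < (Finset.univ : Finset (Fin n)).card := by
      refine Finset.card_lt_card ⟨Finset.filter_subset _ _, fun hsub => ?_⟩
      have := hsub (Finset.mem_univ i)
      exact not_closer_self x z i (by simpa using this)
    simpa using this
  have hinj : Function.Injective fun i => (⟨r i, hrn i⟩ : Fin n) := fun a b hab => by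
    by_contra hne
    have hab : r a = r b := by simpa using hab
    rcases closer_or_closer_of_ne x z hne with h | h
    · exact (hlt _ _ h).ne hab
    · exact (hlt _ _ h).ne' hab
  have hbij := Finite.injective_iff_bijective.1 hinj
  have : neighbors k x z = Finset.univ.filter fun i => r i < k := by
    ext i; simp [mem_neighbors, r]
  rw [this]
  have h2 : (Finset.univ.filter fun i => r i < k).card
      = (Finset.univ.filter fun i : Fin n => (i : ℕ) < k).card := by
    refine Finset.card_bij (fun i _ => ⟨r i, hrn i⟩) (by simp) (fun a _ b _ h => hinj h) ?_
    intro b hb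
    obtain ⟨a, ha⟩ := hbij.2 b
    refine ⟨a, ?_, ha⟩
    have : r a = (b : ℕ) := by rw [← ha]
    simpa [this] using hb
  rw [h2, Fin.card_filter_val_lt, min_eq_right hk]

open Classical in
/-- If at least `k` sample points lie in a set of diameter at most `η` containing `z`, then all
the `k` nearest neighbours of `z` are at distance at most `η`. -/
theorem dist_le_of_mem_neighbors {k : ℕ} {x : Fin n → E} {z : E} {s : Set E} {η : ℝ}
    (hs : ∀ a ∈ s, ∀ b ∈ s, dist a b ≤ η) (hz : z ∈ s)
    (hcard : k ≤ (Finset.univ.filter fun j => x j ∈ s).card) {j : Fin n}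
    (hj : j ∈ neighbors k x z) : dist (x j) z ≤ η := by
  by_contra! hlt
  rw [mem_neighbors] at hj
  refine absurd (hcard.trans (Finset.card_le_card fun i hi => ?_)) (not_le.2 hj)
  simp only [Finset.mem_filter, Finset.mem_univ, true_and] at hi ⊢
  exact Or.inl ((hs _ hi _ hz).trans_lt hlt)

end Neighbors

/-! ### Stone's lemma by a cone covering -/

section Stone

open Classical in
/-- **Stone's lemma**: a sample point is among the `k` nearest neighbours of at most `γ k` sample
points, where `γ` depends on the space only. -/
theorem exists_card_filter_mem_neighbors_le (V : Type*) [NormedAddCommGroup V] [NormedSpace ℝ V]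
    [FiniteDimensional ℝ V] :
    ∃ γ : ℕ, ∀ (n k : ℕ) (x : Fin n → V), Function.Injective x → 0 < k → ∀ j,
      (Finset.univ.filter fun i => j ∈ neighbors k x (x i)).card ≤ γ * k := by
  have : ProperSpace V := FiniteDimensional.proper ℝ V
  obtain ⟨t, -, htfin, ht⟩ := (isCompact_sphere (0 : V) 1).finite_cover_balls (half_pos one_pos)
  lift t to Finset V using htfin
  refine ⟨t.card + 1, fun n k x hx hk j => ?_⟩
  let u : Fin n → V := fun i => ‖x i - x j‖⁻¹ • (x i - x j)
  let C : V → Finset (Fin n) := fun c =>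
    Finset.univ.filter fun i => j ∈ neighbors k x (x i) ∧ i ≠ j ∧ u i ∈ Metric.ball c (1 / 2)
  have hpos : ∀ i, i ≠ j → 0 < ‖x i - x j‖ := fun i hi =>
    norm_pos_iff.2 (sub_ne_zero.2 fun h => hi (hx h))
  have hsub : (Finset.univ.filter fun i => j ∈ neighbors k x (x i)) ⊆ {j} ∪ t.biUnion C := by
    intro i hi
    simp only [Finset.mem_filter, Finset.mem_univ, true_and] at hi
    by_cases hij : i = j
    · simp [hij]
    · have hu : u i ∈ Metric.sphere (0 : V) 1 := by
        simp [u, norm_smul, (hpos i hij).ne']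
      obtain ⟨c, hc, hic⟩ := Set.mem_iUnion₂.1 (ht hu)
      refine Finset.mem_union_right _ (Finset.mem_biUnion.2 ⟨c, hc, ?_⟩)
      simp only [C, Finset.mem_filter, Finset.mem_univ, true_and]
      exact ⟨hi, hij, hic⟩
  -- `C c` collects the points seen from `x j` in directions within `1/2` of `c`. If `b` is the
  -- farthest of them, each member, `b` included, is closer to `x b` than `x j` is. As `j` is a
  -- `k`-neighbour of `x b`, there are fewer than `k` of them.
  have hC : ∀ c, (C c).card ≤ k := fun c => by
    rcases (C c).eq_empty_or_nonempty with h | h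
    · simp [h]
    obtain ⟨b, hb, hmax⟩ := (C c).exists_max_image (fun i => ‖x i - x j‖) h
    have hb' := hb
    simp only [C, Finset.mem_filter, Finset.mem_univ, true_and] at hb'
    have hlt := mem_neighbors.1 hb'.1
    refine (Finset.card_le_card fun i hi => ?_).trans hlt.le
    have hmaxi := hmax i hi
    simp only [C, Finset.mem_filter, Finset.mem_univ, true_and] at hi ⊢
    left
    have h1 := hpos i hi.2.1
    have h2 := hpos b hb'.2.1
    have huu : ‖u i - u b‖ < 1 := by
      rw [← dist_eq_norm]
      calc dist (u i) (u b) ≤ dist (u i) c + dist (u b) c := dist_triangle_right _ _ _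
        _ < 1 / 2 + 1 / 2 := add_lt_add (Metric.mem_ball.1 hi.2.2) (Metric.mem_ball.1 hb'.2.2)
        _ = 1 := by norm_num
    have hi' : x i - x j = ‖x i - x j‖ • u i := by
      simp [u, smul_smul, mul_inv_cancel₀ h1.ne']
    have hbb : x b - x j = ‖x b - x j‖ • u b := by
      simp [u, smul_smul, mul_inv_cancel₀ h2.ne']
    have hub : ‖u b‖ = 1 := by simp [u, norm_smul, h2.ne']
    -- With `r` the distance to `x j`, this gives `‖x i - x b‖ ≤ r i * ‖u i - u b‖ + (r b - r i)`,
    -- which is below `r b` because the directions differ by less than `1`.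
    have hdec : x i - x b = ‖x i - x j‖ • (u i - u b) - (‖x b - x j‖ - ‖x i - x j‖) • u b := by
      rw [smul_sub, sub_smul, ← hi', ← hbb]; abel
    rw [dist_eq_norm, hdec, dist_comm, dist_eq_norm]
    calc _ ≤ ‖‖x i - x j‖ • (u i - u b)‖ + ‖(‖x b - x j‖ - ‖x i - x j‖) • u b‖ := norm_sub_le _ _
      _ = ‖x i - x j‖ * ‖u i - u b‖ + (‖x b - x j‖ - ‖x i - x j‖) := by
          rw [norm_smul, norm_smul, hub, norm_norm, Real.norm_of_nonneg (sub_nonneg.2 hmaxi),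
            mul_one]
      _ < ‖x i - x j‖ * 1 + (‖x b - x j‖ - ‖x i - x j‖) := by gcongr
      _ = ‖x b - x j‖ := by ring
  calc _ ≤ ({j} ∪ t.biUnion C).card := Finset.card_le_card hsub
    _ ≤ 1 + ∑ c ∈ t, (C c).card :=
        (Finset.card_union_le _ _).trans (add_le_add (by simp) Finset.card_biUnion_le)
    _ ≤ 1 + ∑ c ∈ t, k := by gcongr with c; exact hC c
    _ ≤ (t.card + 1) * k := by
        rw [Finset.sum_const, smul_eq_mul, add_mul, one_mul, add_comm]; omega

theorem neighbors_subtype {V : Type*} [PseudoMetricSpace V] {s : Set V} {n : ℕ} (k : ℕ)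
    (x : Fin n → s) (z : s) :
    neighbors k x z = neighbors k (fun i => (x i : V)) (z : V) := rfl

end Stone

/-! ### Bias of the nearest neighbours smoother -/

section Bias

variable {E : Type*} [PseudoMetricSpace E] {n : ℕ}

theorem knnEstimate_sub (k : ℕ) (x : Fin n → E) (y y' : Fin n → ℝ) (z : E) :
    knnEstimate k x (fun i => y i - y' i) z = knnEstimate k x y z - knnEstimate k x y' z := by
  simp [knnEstimate, mul_sub]

theorem sq_knnEstimate_le {k : ℕ} (hk : 0 < k) (hkn : k ≤ n) (x : Fin n → E) (v : Fin n → ℝ)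
    (z : E) : knnEstimate k x v z ^ 2 ≤ (1 / (k : ℝ)) * ∑ j ∈ neighbors k x z, v j ^ 2 := by
  have hk' : (0 : ℝ) < k := by exact_mod_cast hk
  have := sq_sum_le_card_mul_sum_sq (s := neighbors k x z) (f := v)
  rw [card_neighbors hkn] at this
  unfold knnEstimate
  rw [mul_pow]
  calc (1 / (k : ℝ)) ^ 2 * (∑ i ∈ neighbors k x z, v i) ^ 2
      ≤ (1 / (k : ℝ)) ^ 2 * (k * ∑ j ∈ neighbors k x z, v j ^ 2) := by gcongr
    _ = _ := by field_simp

-- Double counting after Cauchy–Schwarz: each `v j ^ 2` enters with weight `1 / k` once for every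
-- sample point having `j` as a neighbour, hence at most `γ k` times. This makes the smoother
-- bounded in empirical `L²`.
open Classical in
theorem sum_sq_knnEstimate_le {k γ : ℕ} (hk : 0 < k) (hkn : k ≤ n) (x : Fin n → E)
    (hγ : ∀ j, (Finset.univ.filter fun i => j ∈ neighbors k x (x i)).card ≤ γ * k)
    (v : Fin n → ℝ) : ∑ i, knnEstimate k x v (x i) ^ 2 ≤ γ * ∑ j, v j ^ 2 := by
  have hk' : (0 : ℝ) < k := by exact_mod_cast hk
  calc ∑ i, knnEstimate k x v (x i) ^ 2
      ≤ ∑ i, (1 / (k : ℝ)) * ∑ j ∈ neighbors k x (x i), v j ^ 2 :=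
        Finset.sum_le_sum fun i _ => sq_knnEstimate_le hk hkn x v (x i)
    _ = (1 / (k : ℝ)) * ∑ j, ∑ i ∈ Finset.univ.filter (fun i => j ∈ neighbors k x (x i)),
          v j ^ 2 := by
        rw [← Finset.mul_sum]
        congr 1
        refine Finset.sum_comm' ?_
        simp
    _ ≤ (1 / (k : ℝ)) * ∑ j, (γ * k) * v j ^ 2 := by
        gcongr with j
        rw [Finset.sum_const, nsmul_eq_mul]
        gcongr
        exact_mod_cast hγ j
    _ = γ * ∑ j, v j ^ 2 := by
        rw [← Finset.mul_sum]; field_simp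

theorem abs_sub_knnEstimate_le {k : ℕ} (hk : 0 < k) (hkn : k ≤ n) (x : Fin n → E)
    (v : Fin n → ℝ) (z : E) (a τ : ℝ) (h : ∀ j ∈ neighbors k x z, |a - v j| ≤ τ) :
    |a - knnEstimate k x v z| ≤ τ := by
  have hk' : (0 : ℝ) < k := by exact_mod_cast hk
  have hc := card_neighbors hkn x z
  have : a - knnEstimate k x v z = (1 / (k : ℝ)) * ∑ j ∈ neighbors k x z, (a - v j) := by
    rw [Finset.sum_sub_distrib, Finset.sum_const, hc, nsmul_eq_mul, knnEstimate]
    field_simp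
  rw [this, abs_mul, abs_of_pos (by positivity)]
  calc (1 / (k : ℝ)) * |∑ j ∈ neighbors k x z, (a - v j)|
      ≤ (1 / (k : ℝ)) * ∑ j ∈ neighbors k x z, τ := by
        gcongr
        exact (Finset.abs_sum_le_sum_abs _ _).trans (Finset.sum_le_sum h)
    _ = τ := by rw [Finset.sum_const, hc, nsmul_eq_mul]; field_simp

open Classical in
/-- The empirical squared bias of the nearest neighbours smoother of `h`, in terms of an
approximation `g` of `h` that varies little between neighbours away from the indices in `B`. -/
theorem sum_sq_sub_knnEstimate_le {k γ : ℕ} (hk : 0 < k) (hkn : k ≤ n) (x : Fin n → E)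
    (hγ : ∀ j, (Finset.univ.filter fun i => j ∈ neighbors k x (x i)).card ≤ γ * k)
    (h g : E → ℝ) {M τ : ℝ} (hM : ∀ z, |g z| ≤ M) (B : Finset (Fin n))
    (hB : ∀ i ∉ B, ∀ j ∈ neighbors k x (x i), |g (x i) - g (x j)| ≤ τ) :
    ∑ i, (h (x i) - knnEstimate k x (fun j => h (x j)) (x i)) ^ 2
      ≤ 3 * (1 + γ) * ∑ j, (h (x j) - g (x j)) ^ 2 + 3 * n * τ ^ 2
        + 12 * M ^ 2 * B.card := by
  have hS := sum_sq_knnEstimate_le hk hkn x hγ (fun j => h (x j) - g (x j))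
  have hmid : ∑ i, (g (x i) - knnEstimate k x (fun j => g (x j)) (x i)) ^ 2
      ≤ n * τ ^ 2 + 4 * M ^ 2 * B.card := by
    have : ∀ i, (g (x i) - knnEstimate k x (fun j => g (x j)) (x i)) ^ 2
        ≤ τ ^ 2 + if i ∈ B then 4 * M ^ 2 else 0 := fun i => by
      split_ifs with hi
      · have := abs_sub_knnEstimate_le hk hkn x (fun j => g (x j)) (x i) (g (x i)) (2 * M)
          fun j _ => (abs_sub _ _).trans (by linarith [hM (x i), hM (x j)])
        have := sq_le_sq' (abs_le.1 this).1 (abs_le.1 this).2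
        nlinarith [sq_nonneg τ]
      · have := abs_sub_knnEstimate_le hk hkn x (fun j => g (x j)) (x i) (g (x i)) τ (hB i hi)
        have := sq_le_sq' (abs_le.1 this).1 (abs_le.1 this).2
        linarith
    refine (Finset.sum_le_sum fun i _ => this i).trans_eq ?_
    rw [Finset.sum_add_distrib, Finset.sum_ite_mem]
    simp [mul_comm]
  calc _ ≤ ∑ i, 3 * ((h (x i) - g (x i)) ^ 2
            + (g (x i) - knnEstimate k x (fun j => g (x j)) (x i)) ^ 2
            + knnEstimate k x (fun j => h (x j) - g (x j)) (x i) ^ 2) := by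
        refine Finset.sum_le_sum fun i _ => ?_
        rw [knnEstimate_sub]
        set a := h (x i); set b := g (x i)
        set c := knnEstimate k x (fun j => g (x j)) (x i)
        set e := knnEstimate k x (fun j => h (x j)) (x i)
        -- `a - e = (a - b) + (b - c) - (e - c)`, and the square of a sum of three terms is at most
        -- three times the sum of squares.
        nlinarith [sq_nonneg ((a - b) - (b - c)), sq_nonneg ((a - b) + (e - c)),
          sq_nonneg ((b - c) + (e - c))]
    _ = 3 * ∑ i, (h (x i) - g (x i)) ^ 2
          + 3 * ∑ i, (g (x i) - knnEstimate k x (fun j => g (x j)) (x i)) ^ 2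
          + 3 * ∑ i, knnEstimate k x (fun j => h (x j) - g (x j)) (x i) ^ 2 := by
        rw [← Finset.mul_sum, Finset.sum_add_distrib, Finset.sum_add_distrib]; ring
    _ ≤ _ := by nlinarith

end Bias

open Classical in
/-- Few sample points lie in cells with few sample points. -/
theorem card_sparse_le {E ι : Type*} {n : ℕ} (T : Finset ι) (A : ι → Set E) (k : ℕ) (x : Fin n → E) :
    (Finset.univ.filter fun i => ∃ c ∈ T, x i ∈ A c ∧
      (Finset.univ.filter fun j => x j ∈ A c).card < k).card ≤ T.card * k := by
  calc _ ≤ ((T.filter fun c => (Finset.univ.filter fun j => x j ∈ A c).card < k).biUnion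
        fun c => Finset.univ.filter fun j => x j ∈ A c).card := by
        refine Finset.card_le_card fun i hi => ?_
        simp only [Finset.mem_filter, Finset.mem_univ, true_and] at hi
        obtain ⟨c, hc, h1, h2⟩ := hi
        refine Finset.mem_biUnion.2 ⟨c, Finset.mem_filter.2 ⟨hc, h2⟩, by simpa using h1⟩
    _ ≤ ∑ c ∈ T.filter fun c => (Finset.univ.filter fun j => x j ∈ A c).card < k,
          (Finset.univ.filter fun j => x j ∈ A c).card := Finset.card_biUnion_le
    _ ≤ ∑ c ∈ T.filter fun c => (Finset.univ.filter fun j => x j ∈ A c).card < k, k :=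
        Finset.sum_le_sum fun c hc => (Finset.mem_filter.1 hc).2.le
    _ ≤ T.card * k := by
        rw [Finset.sum_const, smul_eq_mul]
        gcongr
        exact Finset.filter_subset _ _

/-! ### Product measures: redrawing a coordinate, Hoeffding's inequality -/

section Product

variable {α : Type*} [MeasurableSpace α] {n : ℕ}

/-- Resampling one coordinate preserves a product measure. -/
theorem measurePreserving_update (R : Measure α) [IsProbabilityMeasure R] (j : Fin n) :
    MeasurePreserving (fun p : (Fin n → α) × α => Function.update p.1 j p.2)
      ((Measure.pi fun _ => R).prod R) (Measure.pi fun _ => R) := by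
  have hm : Measurable (fun p : (Fin n → α) × α => Function.update p.1 j p.2) := by
    refine measurable_pi_iff.2 fun i => ?_
    by_cases hi : i = j
    · subst hi; simpa using measurable_snd
    · simpa [Function.update_of_ne hi] using by fun_prop
  refine ⟨hm, (Measure.pi_eq fun s hs => ?_).symm⟩
  rw [Measure.map_apply hm (MeasurableSet.univ_pi hs)]
  have : (fun p : (Fin n → α) × α => Function.update p.1 j p.2) ⁻¹' Set.univ.pi s
      = (Set.univ.pi (Function.update s j Set.univ)) ×ˢ (s j) := by
    ext p
    simp only [Set.mem_preimage, Set.mem_pi, Set.mem_univ, true_implies, Set.mem_prod]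
    constructor
    · intro h
      refine ⟨fun i => ?_, by simpa using h j⟩
      by_cases hi : i = j
      · subst hi; simp
      · simpa [Function.update_of_ne hi] using h i
    · rintro ⟨h, h'⟩ i
      by_cases hi : i = j
      · subst hi; simpa using h'
      · simpa [Function.update_of_ne hi] using h i
  rw [this, Measure.prod_prod, Measure.pi_pi, ← Finset.mul_prod_erase _ _ (Finset.mem_univ j),
    ← Finset.mul_prod_erase Finset.univ (fun i => R (s i)) (Finset.mem_univ j)]
  rw [Function.update_self, measure_univ, one_mul, mul_comm]
  congr 1
  refine Finset.prod_congr rfl fun i hi => ?_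
  rw [Function.update_of_ne (Finset.ne_of_mem_erase hi)]

theorem ae_pi_eval {R : Measure α} [IsProbabilityMeasure R] {p : α → Prop} (h : ∀ᵐ a ∂ R, p a) :
    ∀ᵐ z ∂(Measure.pi fun _ : Fin n => R), ∀ i, p (z i) :=
  ae_all_iff.2 fun i =>
    (measurePreserving_eval (fun _ : Fin n => R) i).quasiMeasurePreserving.ae h

/-- **Hoeffding's inequality** for the empirical mean of a bounded function. -/
theorem exists_pi_real_sum_ge_le (R : Measure α) [IsProbabilityMeasure R] {φ : α → ℝ}
    (hφ : Measurable φ) {M : ℝ} (hM : ∀ a, |φ a| ≤ M) {t : ℝ} (ht : 0 < t) :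
    ∃ c : ℝ, 0 < c ∧ ∀ n : ℕ, (Measure.pi fun _ : Fin n => R).real
      {z | n * (∫ a, φ a ∂ R + t) ≤ ∑ i, φ (z i)} ≤ Real.exp (-c * n) := by
  -- Keeps the variance proxy `C` positive even when `M = 0`, so that the rate `t ^ 2 / (2 * C)` is
  -- meaningful.
  set M' := max M 1
  have hM' : ∀ a, φ a ∈ Set.Icc (-M') M' := fun a =>
    abs_le.1 ((hM a).trans (le_max_left _ _))
  have hpos : 0 < M' := lt_max_of_lt_right one_pos
  have hsub := hasSubgaussianMGF_of_mem_Icc (μ := R) hφ.aemeasurable (ae_of_all _ hM')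
  set C := (‖M' - -M'‖₊ / 2) ^ 2 with hC
  have hCpos : (0 : ℝ) < C := by
    rw [hC]; push_cast
    have : 0 < ‖M' - -M'‖ := norm_pos_iff.2 (by linarith)
    positivity
  refine ⟨t ^ 2 / (2 * C), by positivity, fun n => ?_⟩
  have hind : iIndepFun (fun (i : Fin n) (z : Fin n → α) => φ (z i) - ∫ a, φ a ∂ R)
      (Measure.pi fun _ : Fin n => R) :=
    iIndepFun_pi (X := fun _ a => φ a - ∫ a, φ a ∂ R)
      fun i => (hφ.sub_const _).aemeasurable
  have hs : ∀ i ∈ (Finset.univ : Finset (Fin n)),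
      HasSubgaussianMGF (fun (z : Fin n → α) => φ (z i) - ∫ a, φ a ∂ R) C
        (Measure.pi fun _ : Fin n => R) := fun i _ => by
    have hmp := measurePreserving_eval (fun _ : Fin n => R) i
    exact HasSubgaussianMGF.of_map (Y := Function.eval i)
      (X := fun a => φ a - ∫ a, φ a ∂ R) hmp.measurable.aemeasurable (by rw [hmp.map_eq]; exact hsub)
  have := HasSubgaussianMGF.measure_sum_ge_le_of_iIndepFun hind hs (ε := n * t) (by positivity)
  refine (le_of_eq ?_).trans (this.trans (Real.exp_le_exp.2 (le_of_eq ?_)))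
  · congr 1; ext z
    simp only [Set.mem_ofPred_eq, Finset.sum_sub_distrib, Finset.sum_const, Finset.card_univ,
      Fintype.card_fin, nsmul_eq_mul]
    constructor <;> intro h <;> linarith
  · rcases n.eq_zero_or_pos with rfl | hn
    · simp
    · simp only [Finset.sum_const, Finset.card_univ, Fintype.card_fin, nsmul_eq_mul, NNReal.coe_mul, NNReal.coe_natCast]
      have : (0 : ℝ) < n := by exact_mod_cast hn
      field_simp

end Product

/-! ### Integrating out the label noise -/

section Noise

variable {E : Type*} [MeasurableSpace E] {n : ℕ}

/-- The labels have conditional mean `h`, tested against bounded functions of the inputs. -/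
def HasConditionalMean (R : Measure (E × ℝ)) (h : E → ℝ) : Prop :=
  ∀ φ : E → ℝ, Measurable φ → (∃ C, ∀ x, |φ x| ≤ C) → ∫ z, φ z.1 * (z.2 - h z.1) ∂ R = 0

/-- Redraw the pair at `j` with the others frozen: `Φ` becomes a function of the new input alone,
and `HasConditionalMean` annihilates the inner integral. The bound on `Φ` may depend on the frozen
coordinates, since labels are bounded only almost surely. -/
theorem integral_mul_sub_eq_zero {R : Measure (E × ℝ)} [IsProbabilityMeasure R] {h : E → ℝ}
    (hmean : HasConditionalMean R h) (j : Fin n) {Φ : (Fin n → E × ℝ) → ℝ}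
    (hint : Integrable (fun z => Φ z * ((z j).2 - h (z j).1)) (Measure.pi fun _ => R))
    (hΦ : Measurable Φ) (hbdd : ∀ z, ∃ C, ∀ x, |Φ (Function.update z j x)| ≤ C)
    (hdep : ∀ z x w w', Φ (Function.update z j (x, w)) = Φ (Function.update z j (x, w'))) :
    ∫ z, Φ z * ((z j).2 - h (z j).1) ∂(Measure.pi fun _ => R) = 0 := by
  have hmp := measurePreserving_update R j
  rw [← hmp.map_eq, integral_map hmp.measurable.aemeasurable
    (by rw [hmp.map_eq]; exact hint.aestronglyMeasurable),
    integral_prod (fun p : (Fin n → E × ℝ) × E × ℝ => Φ (Function.update p.1 j p.2) *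
      ((Function.update p.1 j p.2 j).2 - h (Function.update p.1 j p.2 j).1))
      (hmp.integrable_comp_of_integrable hint)]
  refine integral_eq_zero_of_ae (ae_of_all _ fun z => ?_)
  have := hmean (fun x => Φ (Function.update z j (x, 0)))
    (hΦ.comp (measurable_update z |>.comp (measurable_id.prodMk measurable_const)))
    (by obtain ⟨C, hC⟩ := hbdd z; exact ⟨C, fun x => hC _⟩)
  simp only [Function.update_self, Pi.zero_apply]
  rw [← this]
  refine integral_congr_ae (ae_of_all _ fun y => ?_)
  have h1 := hdep z y.1 y.2 0
  simp only [Prod.mk.eta] at h1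
  simp only [h1]

/-- This replaces conditioning on the inputs. Expand the factor at `j`: the other factors do not
involve the label at `j`, so the term linear in the noise integrates to zero. The quantifier over
`G` is kept inside the induction so that `G` can absorb the factors `1 + 4 * a j ^ 2` already freed
of noise. -/
theorem integral_prod_noise {R : Measure (E × ℝ)} [IsProbabilityMeasure R]
    (hR : ∀ᵐ z ∂ R, |z.2| ≤ 1) {h : E → ℝ} (hh : Measurable h) (hh1 : ∀ x, |h x| ≤ 1)
    (hmean : HasConditionalMean R h) {a : Fin n → (Fin n → E) → ℝ} (ha : ∀ j, Measurable (a j))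
    (ha1 : ∀ j x, |a j x| ≤ 1 / 2) (S : Finset (Fin n)) :
    ∀ {G : (Fin n → E) → ℝ} (_ : Measurable G) (_ : ∃ C, ∀ x, |G x| ≤ C),
    ∫ z, G (fun i => (z i).1) * ∏ j ∈ S, (1 + 4 * a j (fun i => (z i).1) ^ 2
        + a j (fun i => (z i).1) * ((z j).2 - h (z j).1)) ∂(Measure.pi fun _ : Fin n => R)
      = ∫ z, G (fun i => (z i).1) * ∏ j ∈ S, (1 + 4 * a j (fun i => (z i).1) ^ 2)
        ∂(Measure.pi fun _ : Fin n => R) := by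
  have hx : Measurable fun (z : Fin n → E × ℝ) (i : Fin n) => (z i).1 := by fun_prop
  have hL : ∀ (j : Fin n) (z : Fin n → E × ℝ), |1 + 4 * a j (fun i => (z i).1) ^ 2
      + a j (fun i => (z i).1) * ((z j).2 - h (z j).1)| ≤ 3 + |(z j).2| := fun j z => by
    have h1 := ha1 j (fun i => (z i).1)
    have h2 := hh1 (z j).1
    have h3 : a j (fun i => (z i).1) ^ 2 ≤ 1 / 4 := by
      have := sq_le_sq' (abs_le.1 h1).1 (abs_le.1 h1).2; linarith
    have h4 : |a j (fun i => (z i).1) * ((z j).2 - h (z j).1)| ≤ 1 / 2 * (|(z j).2| + 1) := by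
      rw [abs_mul]
      gcongr
      exact (abs_sub _ _).trans (by linarith)
    have h5 := abs_nonneg (z j).2
    rw [abs_le] at h4 ⊢
    constructor <;> nlinarith [sq_nonneg (a j (fun i => (z i).1))]
  have hLm : ∀ j, Measurable fun z : Fin n → E × ℝ => 1 + 4 * a j (fun i => (z i).1) ^ 2
      + a j (fun i => (z i).1) * ((z j).2 - h (z j).1) := fun j => by
    have := (ha j).comp hx
    simp only [Function.comp_def] at this
    fun_prop
  induction S using Finset.induction_on with
  | empty => intros; simp
  | insert j S hj ih =>
    intro G hG ⟨C, hC⟩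
    have hC0 : ∀ x, 0 ≤ C := fun x => (abs_nonneg _).trans (hC x)
    have hprod : ∀ z : Fin n → E × ℝ, |∏ j ∈ S, (1 + 4 * a j (fun i => (z i).1) ^ 2
        + a j (fun i => (z i).1) * ((z j).2 - h (z j).1))| ≤ ∏ j ∈ S, (3 + |(z j).2|) := fun z => by
      rw [Finset.abs_prod]
      exact Finset.prod_le_prod (fun _ _ => abs_nonneg _) fun j _ => hL j z
    have hGm := hG.comp hx
    have ham := (ha j).comp hx
    simp only [Function.comp_def] at hGm ham
    have hPm : Measurable fun z : Fin n → E × ℝ => ∏ j ∈ S, (1 + 4 * a j (fun i => (z i).1) ^ 2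
        + a j (fun i => (z i).1) * ((z j).2 - h (z j).1)) :=
      Finset.measurable_prod _ fun j _ => hLm j
    have hae := ae_pi_eval (n := n) hR
    have hprod' : ∀ᵐ z ∂(Measure.pi fun _ : Fin n => R),
        |∏ j ∈ S, (1 + 4 * a j (fun i => (z i).1) ^ 2
          + a j (fun i => (z i).1) * ((z j).2 - h (z j).1))| ≤ 4 ^ S.card := by
      filter_upwards [hae] with z hz
      refine (hprod z).trans ?_
      rw [← Finset.prod_const]
      exact Finset.prod_le_prod (fun _ _ => by positivity) fun i _ => by linarith [hz i]
    have hi1 : Integrable (fun z : Fin n → E × ℝ =>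
        (G (fun i => (z i).1) * (1 + 4 * a j (fun i => (z i).1) ^ 2)) *
          ∏ j ∈ S, (1 + 4 * a j (fun i => (z i).1) ^ 2
            + a j (fun i => (z i).1) * ((z j).2 - h (z j).1))) (Measure.pi fun _ => R) := by
      refine Integrable.of_bound (by fun_prop) (C * 2 * 4 ^ S.card) ?_
      filter_upwards [hprod'] with z hz
      rw [Real.norm_eq_abs, abs_mul, abs_mul]
      have h1 := ha1 j (fun i => (z i).1)
      have := hC0 (fun i => (z i).1)
      gcongr
      · exact hC _
      · have := sq_le_sq' (abs_le.1 h1).1 (abs_le.1 h1).2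
        rw [abs_of_nonneg (by positivity)]; linarith
    have hi2 : Integrable (fun z : Fin n → E × ℝ =>
        (G (fun i => (z i).1) * a j (fun i => (z i).1) *
          ∏ j ∈ S, (1 + 4 * a j (fun i => (z i).1) ^ 2
            + a j (fun i => (z i).1) * ((z j).2 - h (z j).1))) * ((z j).2 - h (z j).1))
          (Measure.pi fun _ => R) := by
      refine Integrable.of_bound (by fun_prop) (C * (1 / 2) * 4 ^ S.card * 2) ?_
      filter_upwards [hprod', hae] with z hz hz'
      rw [Real.norm_eq_abs, abs_mul, abs_mul, abs_mul]
      have := hC0 (fun i => (z i).1)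
      gcongr
      · exact hC _
      · exact ha1 j _
      · exact (abs_sub _ _).trans (by linarith [hz' j, hh1 (z j).1])
    have hzero := integral_mul_sub_eq_zero hmean j hi2 (by fun_prop)
      (fun z => ⟨C * (1 / 2) * ∏ i ∈ S, (3 + |(z i).2|), fun y => by
        rw [abs_mul, abs_mul]
        have := hC0 (fun i => (z i).1)
        gcongr
        · exact hC _
        · exact ha1 j _
        · refine (hprod _).trans (le_of_eq (Finset.prod_congr rfl fun i hi => ?_))
          rw [Function.update_of_ne (ne_of_mem_of_not_mem hi hj)]⟩)
      (fun z x w w' => by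
        have h1 : ∀ w, (fun i => ((Function.update z j (x, w) : Fin n → E × ℝ) i).1)
            = Function.update (fun i => (z i).1) j x := fun w => by
          ext1 i
          by_cases hi : i = j
          · subst hi; simp
          · simp [Function.update_of_ne hi]
        simp only [h1]
        congr 1
        refine Finset.prod_congr rfl fun i hi => ?_
        have hij := ne_of_mem_of_not_mem hi hj
        rw [Function.update_of_ne hij, Function.update_of_ne hij])
    have hG' : Measurable fun x => G x * (1 + 4 * a j x ^ 2) := by
      have := ha j; fun_prop
    have := ih hG' ⟨C * 2, fun x => by
      rw [abs_mul]
      have := hC0 x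
      gcongr
      · exact hC _
      · have h1 := ha1 j x
        have := sq_le_sq' (abs_le.1 h1).1 (abs_le.1 h1).2
        rw [abs_of_nonneg (by positivity)]; linarith⟩
    calc _ = ∫ z, ((G (fun i => (z i).1) * (1 + 4 * a j (fun i => (z i).1) ^ 2)) *
          ∏ j ∈ S, (1 + 4 * a j (fun i => (z i).1) ^ 2
            + a j (fun i => (z i).1) * ((z j).2 - h (z j).1)) +
          (G (fun i => (z i).1) * a j (fun i => (z i).1) *
          ∏ j ∈ S, (1 + 4 * a j (fun i => (z i).1) ^ 2
            + a j (fun i => (z i).1) * ((z j).2 - h (z j).1))) * ((z j).2 - h (z j).1))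
          ∂(Measure.pi fun _ : Fin n => R) := by
          refine integral_congr_ae (ae_of_all _ fun z => ?_)
          simp only [Finset.prod_insert hj]
          ring
      _ = _ := by
          rw [integral_add hi1 hi2, hzero, add_zero, this]
          refine integral_congr_ae (ae_of_all _ fun z => ?_)
          simp only [Finset.prod_insert hj]
          ring

end Noise

/-! ### Chernoff bound for the noise averages -/

section NoiseTail

variable {E : Type*} [PseudoMetricSpace E] [SecondCountableTopology E] [MeasurableSpace E]
  [OpensMeasurableSpace E] {n : ℕ}

open Classical in
theorem measurableSet_mem_neighbors (k : ℕ) (i j : Fin n) :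
    MeasurableSet {x : Fin n → E | j ∈ neighbors k x (x i)} := by
  have hd : ∀ l : Fin n, Measurable fun x : Fin n → E => dist (x l) (x i) := fun l => by
    fun_prop
  have hcl : ∀ l : Fin n, MeasurableSet {x : Fin n → E | Closer x (x i) l j} := fun l =>
    (measurableSet_lt (hd l) (hd j)).union
      ((measurableSet_eq_fun (hd l) (hd j)).inter (MeasurableSet.const _))
  have hcard : Measurable fun x : Fin n → E =>
      (Finset.univ.filter fun l => Closer x (x i) l j).card := by
    simp only [Finset.card_filter]
    exact Finset.measurable_sum _ fun l _ =>
      Measurable.ite (hcl l) measurable_const measurable_const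
  simp only [mem_neighbors]
  exact measurableSet_lt hcard measurable_const

-- Write the sum with weights `a j`, equal to `s` on neighbours and `0` elsewhere. Since `exp v ≤ 1
-- + v + v ^ 2` for `|v| ≤ 1` and the noise is at most `2` in absolute value, each exponential is at
-- most `1 + 4 a ^ 2 + a * noise`. The noise integrates out, and `1 + 4 a ^ 2 ≤ exp (4 a ^ 2)` over
-- exactly `k` neighbours gives the bound.
open Classical in
theorem mgf_sum_neighbors_le {R : Measure (E × ℝ)} [IsProbabilityMeasure R]
    (hR : ∀ᵐ z ∂ R, |z.2| ≤ 1) {h : E → ℝ} (hh : Measurable h) (hh1 : ∀ x, |h x| ≤ 1)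
    (hmean : HasConditionalMean R h) {k : ℕ} (hkn : k ≤ n) (i : Fin n) {s : ℝ}
    (hs : |s| ≤ 1 / 2) :
    Integrable (fun z : Fin n → E × ℝ => Real.exp (s *
      ∑ j ∈ neighbors k (fun l => (z l).1) (z i).1, ((z j).2 - h (z j).1)))
        (Measure.pi fun _ => R) ∧
    mgf (fun z : Fin n → E × ℝ =>
      ∑ j ∈ neighbors k (fun l => (z l).1) (z i).1, ((z j).2 - h (z j).1))
        (Measure.pi fun _ => R) s ≤ Real.exp (4 * s ^ 2 * k) := by
  let a : Fin n → (Fin n → E) → ℝ := fun j x => if j ∈ neighbors k x (x i) then s else 0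
  have ha : ∀ j, Measurable (a j) := fun j =>
    Measurable.ite (measurableSet_mem_neighbors k i j) measurable_const measurable_const
  have ha1 : ∀ j x, |a j x| ≤ 1 / 2 := fun j x => by
    simp only [a]; split_ifs
    · exact hs
    · norm_num
  have hx : Measurable fun (z : Fin n → E × ℝ) (i : Fin n) => (z i).1 := by fun_prop
  have ham : ∀ j, Measurable fun z : Fin n → E × ℝ => a j (fun l => (z l).1) := fun j =>
    (ha j).comp hx
  have hsum : ∀ z : Fin n → E × ℝ, s *
      ∑ j ∈ neighbors k (fun l => (z l).1) (z i).1, ((z j).2 - h (z j).1)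
      = ∑ j, a j (fun l => (z l).1) * ((z j).2 - h (z j).1) := fun z => by
    simp only [a, ite_mul, zero_mul, Finset.sum_ite_mem, Finset.univ_inter, Finset.mul_sum]
  have hsq : ∀ x : Fin n → E, ∑ j, 4 * a j x ^ 2 = 4 * s ^ 2 * k := fun x => by
    simp only [a, ite_pow, mul_ite, Finset.sum_ite_mem, Finset.univ_inter, ne_eq,
      OfNat.ofNat_ne_zero, not_false_eq_true, zero_pow, mul_zero]
    rw [Finset.sum_const, card_neighbors hkn, nsmul_eq_mul]; ring
  have hae := ae_pi_eval (n := n) hR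
  have hterm : ∀ᵐ z ∂(Measure.pi fun _ : Fin n => R), ∀ j,
      |a j (fun l => (z l).1) * ((z j).2 - h (z j).1)| ≤ 1 := by
    filter_upwards [hae] with z hz j
    rw [abs_mul]
    have h1 : |(z j).2 - h (z j).1| ≤ 2 := (abs_sub _ _).trans (by linarith [hz j, hh1 (z j).1])
    nlinarith [ha1 j (fun l => (z l).1), abs_nonneg (a j (fun l => (z l).1)),
      abs_nonneg ((z j).2 - h (z j).1)]
  have hfac : ∀ᵐ z ∂(Measure.pi fun _ : Fin n => R), ∀ j,
      Real.exp (a j (fun l => (z l).1) * ((z j).2 - h (z j).1))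
        ≤ 1 + 4 * a j (fun l => (z l).1) ^ 2
          + a j (fun l => (z l).1) * ((z j).2 - h (z j).1) := by
    filter_upwards [hae, hterm] with z hz ht j
    have h1 : |(z j).2 - h (z j).1| ≤ 2 := (abs_sub _ _).trans (by linarith [hz j, hh1 (z j).1])
    have h2 := sq_le_sq' (abs_le.1 h1).1 (abs_le.1 h1).2
    have h3 := abs_le.1 (Real.abs_exp_sub_one_sub_id_le (ht j))
    nlinarith [sq_nonneg (a j (fun l => (z l).1)), mul_le_mul_of_nonneg_left h2
      (sq_nonneg (a j (fun l => (z l).1)))]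
  have hpm : Measurable fun z : Fin n → E × ℝ => ∏ j, (1 + 4 * a j (fun l => (z l).1) ^ 2
      + a j (fun l => (z l).1) * ((z j).2 - h (z j).1)) :=
    Finset.measurable_prod _ fun j _ => by have := ham j; fun_prop
  have hle : ∀ᵐ z ∂(Measure.pi fun _ : Fin n => R), Real.exp (s *
      ∑ j ∈ neighbors k (fun l => (z l).1) (z i).1, ((z j).2 - h (z j).1))
      ≤ ∏ j, (1 + 4 * a j (fun l => (z l).1) ^ 2
        + a j (fun l => (z l).1) * ((z j).2 - h (z j).1)) := by
    filter_upwards [hfac] with z hz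
    rw [hsum, Real.exp_sum]
    exact Finset.prod_le_prod (fun _ _ => (Real.exp_pos _).le) fun j _ => hz j
  have hpint : Integrable (fun z : Fin n → E × ℝ => ∏ j, (1 + 4 * a j (fun l => (z l).1) ^ 2
      + a j (fun l => (z l).1) * ((z j).2 - h (z j).1))) (Measure.pi fun _ => R) := by
    refine Integrable.of_bound hpm.aestronglyMeasurable (3 ^ n) ?_
    filter_upwards [hterm] with z hz
    rw [Real.norm_eq_abs, Finset.abs_prod]
    calc _ ≤ ∏ _j : Fin n, (3 : ℝ) := by
          refine Finset.prod_le_prod (fun _ _ => abs_nonneg _) fun j _ => ?_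
          have h1 := ha1 j (fun l => (z l).1)
          have h2 := sq_le_sq' (abs_le.1 h1).1 (abs_le.1 h1).2
          have h3 := abs_le.1 (hz j)
          rw [abs_le]
          constructor <;> nlinarith [sq_nonneg (a j (fun l => (z l).1))]
      _ = 3 ^ n := by simp
  have hem : Measurable fun z : Fin n → E × ℝ => Real.exp (s *
      ∑ j ∈ neighbors k (fun l => (z l).1) (z i).1, ((z j).2 - h (z j).1)) := by
    simp only [hsum]
    refine Real.measurable_exp.comp (Finset.measurable_sum _ fun j _ => ?_)
    have := ham j; fun_prop
  have heint := hpint.mono' hem.aestronglyMeasurable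
    (by filter_upwards [hle] with z hz; rwa [Real.norm_of_nonneg (Real.exp_pos _).le])
  refine ⟨heint, ?_⟩
  have key := integral_prod_noise hR hh hh1 hmean ha ha1 Finset.univ (G := fun _ => 1)
    measurable_const ⟨1, by simp⟩
  simp only [one_mul] at key
  unfold mgf
  calc _ ≤ _ := integral_mono_ae heint hpint hle
    _ = _ := key
    _ ≤ ∫ z : Fin n → E × ℝ, Real.exp (4 * s ^ 2 * k) ∂(Measure.pi fun _ => R) := by
        refine integral_mono_of_nonneg (ae_of_all _ fun z => ?_) (integrable_const _)
          (ae_of_all _ fun z => ?_)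
        · exact Finset.prod_nonneg fun _ _ => by positivity
        · simp only
          rw [← hsq (fun l => (z l).1), Real.exp_sum]
          refine Finset.prod_le_prod (fun _ _ => by positivity) fun j _ => ?_
          linarith [Real.add_one_le_exp (4 * a j (fun l => (z l).1) ^ 2)]
    _ = _ := by simp

theorem pi_real_abs_knnEstimate_noise_ge_le {R : Measure (E × ℝ)} [IsProbabilityMeasure R]
    (hR : ∀ᵐ z ∂ R, |z.2| ≤ 1) {h : E → ℝ} (hh : Measurable h) (hh1 : ∀ x, |h x| ≤ 1)
    (hmean : HasConditionalMean R h) {k : ℕ} (hk : 0 < k) (hkn : k ≤ n) {t : ℝ} (ht : 0 < t)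
    (ht4 : t ≤ 4) :
    (Measure.pi fun _ : Fin n => R).real {z | ∃ i, t ≤ |knnEstimate k (fun l => (z l).1)
      (fun j => (z j).2 - h (z j).1) (z i).1|} ≤ 2 * n * Real.exp (-(t ^ 2 / 16) * k) := by
  have hk' : (0 : ℝ) < k := by exact_mod_cast hk
  have hone : ∀ i : Fin n, (Measure.pi fun _ : Fin n => R).real
      {z | t ≤ |knnEstimate k (fun l => (z l).1) (fun j => (z j).2 - h (z j).1) (z i).1|}
      ≤ 2 * Real.exp (-(t ^ 2 / 16) * k) := fun i => by
    -- `s = t / 8` minimises `4 * s ^ 2 - s * t`, with value `-t ^ 2 / 16`; the bound `t ≤ 4`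
    -- ensures `s ≤ 1 / 2`.
    obtain ⟨hi1, hm1⟩ := mgf_sum_neighbors_le hR hh hh1 hmean hkn i (s := t / 8)
      (by rw [abs_of_pos (by positivity)]; linarith)
    obtain ⟨hi2, hm2⟩ := mgf_sum_neighbors_le hR hh hh1 hmean hkn i (s := -(t / 8))
      (by rw [abs_neg, abs_of_pos (by positivity)]; linarith)
    have h1 := measure_ge_le_exp_mul_mgf (t * k) (by positivity : 0 ≤ t / 8) hi1
    have h2 := measure_le_le_exp_mul_mgf (-(t * k)) (by linarith : -(t / 8) ≤ 0) hi2
    have hb1 := h1.trans (mul_le_mul_of_nonneg_left hm1 (Real.exp_pos _).le)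
    have hb2 := h2.trans (mul_le_mul_of_nonneg_left hm2 (Real.exp_pos _).le)
    rw [← Real.exp_add] at hb1 hb2
    have he1 : -(t / 8) * (t * k) + 4 * (t / 8) ^ 2 * k = -(t ^ 2 / 16) * k := by ring
    have he2 : -(-(t / 8)) * (-(t * k)) + 4 * (-(t / 8)) ^ 2 * k = -(t ^ 2 / 16) * k := by ring
    rw [he1] at hb1
    rw [he2] at hb2
    rw [two_mul]
    refine (measureReal_mono ?_).trans ((measureReal_union_le _ _).trans (add_le_add hb1 hb2))
    intro z hz
    simp only [Set.mem_ofPred_eq, knnEstimate, le_abs, Set.mem_union] at hz ⊢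
    rcases hz with hz | hz
    · left
      rw [one_div, inv_mul_eq_div, le_div_iff₀ hk'] at hz
      exact hz
    · right
      rw [one_div, inv_mul_eq_div, ← neg_div, le_div_iff₀ hk'] at hz
      linarith
  rw [Set.ofPred_exists]
  refine (measureReal_iUnion_fintype_le _).trans ((Finset.sum_le_sum fun i _ => hone i).trans_eq ?_)
  simp; ring

end NoiseTail

/-! ### Small cells outside a set of small measure -/

section Exceptional

theorem exists_measureReal_lt_of_antitone {α : Type*} [MeasurableSpace α] (ν : Measure α)
    [IsFiniteMeasure ν] {s : ℕ → Set α} (hs : ∀ m, MeasurableSet (s m)) (hanti : Antitone s)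
    (hempty : ∀ a, ∃ m, a ∉ s m) {ε : ℝ} (hε : 0 < ε) : ∃ m, ν.real (s m) < ε := by
  have h := tendsto_measure_iInter_atTop (μ := ν) (fun m => (hs m).nullMeasurableSet) hanti
    ⟨0, measure_ne_top _ _⟩
  have h0 : ⋂ m, s m = ∅ := by
    refine Set.eq_empty_of_forall_notMem fun a ha => ?_
    obtain ⟨m, hm⟩ := hempty a
    exact hm (Set.mem_iInter.1 ha m)
  rw [h0, measure_empty] at h
  have h' := (ENNReal.tendsto_toReal ENNReal.zero_ne_top).comp h
  simp only [ENNReal.toReal_zero] at h'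
  exact (h'.eventually_lt_const hε).exists

/-- Off a set of small measure, the space is covered by finitely many small cells and a continuous
function varies little at the scale of the cells. -/
theorem exists_cells {E : Type*} [PseudoMetricSpace E] [SecondCountableTopology E]
    [MeasurableSpace E] [OpensMeasurableSpace E] (ν : Measure E) [IsProbabilityMeasure ν]
    {g : E → ℝ} (hg : Continuous g) {ε τ : ℝ} (hε : 0 < ε) (hτ : 0 < τ) :
    ∃ (V : Set E) (N : ℕ) (A : ℕ → Set E) (η : ℝ), MeasurableSet V ∧ ν.real V ≤ ε ∧
      (∀ c, ∀ a ∈ A c, ∀ b ∈ A c, dist a b ≤ η) ∧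
      (∀ a ∉ V, ∃ c ∈ Finset.range N, a ∈ A c) ∧
      ∀ a ∉ V, ∀ b, dist b a ≤ η → |g a - g b| ≤ τ := by
  have hne : Nonempty E := by
    by_contra h
    rw [not_nonempty_iff] at h
    have : ν Set.univ = 0 := by rw [Set.univ_eq_empty_iff.2 h, measure_empty]
    simp at this
  -- `W m` is where `g` oscillates by more than `τ` within radius `1 / (m + 1)`. These sets decrease
  -- to the empty set by continuity, so uniform continuity is obtained up to small measure without
  -- compactness.
  let W : ℕ → Set E := fun m => {a | ∃ b, dist b a < 1 / ((m : ℝ) + 1) ∧ τ < |g a - g b|}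
  have hWopen : ∀ m, IsOpen (W m) := fun m => by
    have : W m = ⋃ b, {a | dist b a < 1 / ((m : ℝ) + 1)} ∩ {a | τ < |g a - g b|} := by
      ext a; simp [W]
    rw [this]
    refine isOpen_iUnion fun b => IsOpen.inter ?_ ?_
    · exact isOpen_lt (by fun_prop) continuous_const
    · exact isOpen_lt continuous_const (by fun_prop)
  obtain ⟨m, hm⟩ := exists_measureReal_lt_of_antitone ν (s := W) (fun m => (hWopen m).measurableSet)
    (fun a b hab x ⟨y, hy, hy'⟩ => ⟨y, hy.trans_le (Nat.one_div_le_one_div hab), hy'⟩)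
    (fun a => by
      obtain ⟨δ, hδ, h⟩ := Metric.continuousAt_iff.1 (hg.continuousAt (x := a)) τ hτ
      obtain ⟨m, hm⟩ := exists_nat_one_div_lt hδ
      refine ⟨m, fun ⟨b, hb, hb'⟩ => ?_⟩
      have := h (hb.trans hm)
      rw [Real.dist_eq, abs_sub_comm] at this
      exact absurd this (not_lt.2 hb'.le)) (half_pos hε)
  -- Half the radius defining `W m`, so that `dist b a ≤ η` implies the strict inequality there.
  -- Balls of radius `η / 2` then have diameter at most `η`.
  set η : ℝ := 1 / ((m : ℝ) + 1) / 2 with hη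
  have hη0 : 0 < η := by positivity
  let A : ℕ → Set E := fun c => Metric.ball (TopologicalSpace.denseSeq E c) (η / 2)
  obtain ⟨N, hN⟩ := exists_measureReal_lt_of_antitone ν
    (s := fun N => (⋃ c ∈ Finset.range N, A c)ᶜ)
    (fun N => (Finset.measurableSet_biUnion _ fun c _ => Metric.isOpen_ball.measurableSet).compl)
    (fun a b hab => Set.compl_subset_compl.2 <|
      Set.biUnion_subset_biUnion_left fun c hc => by
        simp only [Finset.mem_coe, Finset.mem_range] at hc ⊢
        exact lt_of_lt_of_le hc hab)
    (fun a => by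
      obtain ⟨c, hc⟩ := (TopologicalSpace.denseRange_denseSeq E).exists_dist_lt a
        (half_pos hη0)
      refine ⟨c + 1, fun h => h ?_⟩
      simp only [Set.mem_iUnion]
      exact ⟨c, by simp, hc⟩) (half_pos hε)
  refine ⟨W m ∪ (⋃ c ∈ Finset.range N, A c)ᶜ, N, A, η,
    (hWopen m).measurableSet.union
      (Finset.measurableSet_biUnion _ fun c _ => Metric.isOpen_ball.measurableSet).compl,
    (measureReal_union_le _ _).trans (by linarith), fun c a ha b hb => ?_, fun a ha => ?_,
    fun a ha b hb => ?_⟩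
  · have := dist_triangle_right a b (TopologicalSpace.denseSeq E c)
    have h1 := Metric.mem_ball.1 ha
    have h2 := Metric.mem_ball.1 hb
    linarith
  · simp only [Set.mem_union, not_or, Set.mem_compl_iff, not_not, Set.mem_iUnion] at ha
    obtain ⟨c, hc, hac⟩ := ha.2
    exact ⟨c, hc, hac⟩
  · simp only [Set.mem_union, not_or] at ha
    by_contra! h
    refine ha.1 ⟨b, hb.trans_lt ?_, h⟩
    exact half_lt_self (by positivity)

end Exceptional

/-! ### Exponential consistency at the sample points -/

/-- Redrawing the pair at `j` hits the input at `i` with probability zero, as there are no atoms.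
Stone's lemma needs the distinct sample points this provides. -/
theorem ae_injective_fst {E : Type*} [MeasurableSpace E] [MeasurableEq E]
    (R : Measure (E × ℝ)) [IsProbabilityMeasure R] (hatom : ∀ a, R.fst {a} = 0) {n : ℕ} :
    ∀ᵐ z ∂(Measure.pi fun _ : Fin n => R), Function.Injective fun i => (z i).1 := by
  have : ∀ i j : Fin n, i ≠ j → ∀ᵐ z ∂(Measure.pi fun _ : Fin n => R), (z i).1 ≠ (z j).1 := by
    intro i j hij
    have hS : MeasurableSet {z : Fin n → E × ℝ | (z i).1 = (z j).1} :=
      measurableSet_eq_fun (by fun_prop) (by fun_prop)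
    have hmp := measurePreserving_update R j
    rw [ae_iff]
    simp only [ne_eq, not_not]
    rw [← hmp.measure_preimage hS.nullMeasurableSet,
      Measure.measure_prod_null (hmp.measurable hS)]
    refine ae_of_all _ fun z => ?_
    simp only [Pi.zero_apply]
    rw [← hatom (z i).1, Measure.fst_apply (MeasurableSet.singleton _)]
    congr 1
    ext y
    simp [Function.update_of_ne hij, eq_comm]
  have h2 : ∀ᵐ z ∂(Measure.pi fun _ : Fin n => R), ∀ i j, i ≠ j → (z i).1 ≠ (z j).1 := by
    simp only [ae_all_iff]
    exact this
  filter_upwards [h2] with z hz i j hij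
  by_contra hne
  exact hz i j hne hij

/-- The empirical squared distance between a function `h` and the nearest neighbours estimate
computed from the sample `z`. -/
noncomputable def knnRisk {E : Type*} [PseudoMetricSpace E] (k : ℕ) (h : E → ℝ) {n : ℕ}
    (z : Fin n → E × ℝ) : ℝ :=
  (1 / (n : ℝ)) * ∑ i, (h (z i).1 -
    knnEstimate k (fun l => (z l).1) (fun l => (z l).2) (z i).1) ^ 2

/-- The risk is bounded by the bias of the smoother and the size of the noise. -/
theorem knnRisk_le {E : Type*} [PseudoMetricSpace E] (k : ℕ) (h : E → ℝ) {n : ℕ}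
    (hn : 0 < n) (z : Fin n → E × ℝ) {t b : ℝ}
    (ht : ∀ i, |knnEstimate k (fun l => (z l).1) (fun j => (z j).2 - h (z j).1) (z i).1| ≤ t)
    (hb : ∑ i, (h (z i).1 - knnEstimate k (fun l => (z l).1) (fun j => h (z j).1) (z i).1) ^ 2
      ≤ n * b) : knnRisk k h z ≤ 2 * b + 2 * t ^ 2 := by
  have hn' : (0 : ℝ) < n := by exact_mod_cast hn
  unfold knnRisk
  rw [one_div, inv_mul_le_iff₀ hn']
  calc _ ≤ ∑ i, (2 * (h (z i).1 -
          knnEstimate k (fun l => (z l).1) (fun j => h (z j).1) (z i).1) ^ 2 + 2 * t ^ 2) := by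
        refine Finset.sum_le_sum fun i _ => ?_
        have h7 := ht i
        rw [knnEstimate_sub k _ (fun l => (z l).2) (fun j => h (z j).1)] at h7
        have h8 := sq_le_sq' (abs_le.1 h7).1 (abs_le.1 h7).2
        set a := h (z i).1
        set p := knnEstimate k (fun l => (z l).1) (fun l => (z l).2) (z i).1
        set q := knnEstimate k (fun l => (z l).1) (fun j => h (z j).1) (z i).1
        nlinarith [sq_nonneg ((a - q) + (p - q))]
    _ ≤ n * (2 * b + 2 * t ^ 2) := by
        rw [Finset.sum_add_distrib, ← Finset.mul_sum]
        simp only [Finset.sum_const, Finset.card_univ, Fintype.card_fin, nsmul_eq_mul]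
        linarith

set_option maxHeartbeats 1000000 in
/-- Exponential consistency of the nearest neighbours estimate at the sample points. -/
theorem exists_knnRisk_tail_le {V : Type*} [NormedAddCommGroup V] [NormedSpace ℝ V]
    [FiniteDimensional ℝ V] [MeasurableSpace V] [BorelSpace V] {𝕏 : Set V} {R : Measure (𝕏 × ℝ)}
    [IsProbabilityMeasure R] (hatom : ∀ a, R.fst {a} = 0) (hR : ∀ᵐ z ∂ R, |z.2| ≤ 1)
    {h : 𝕏 → ℝ} (hh : Measurable h) (hh1 : ∀ x, |h x| ≤ 1) (hmean : HasConditionalMean R h)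
    {k : ℕ → ℕ} (hk : Tendsto (fun n : ℕ => (k n : ℝ) / (n : ℝ)) atTop (𝓝 0))
    (hkpos : ∀ᶠ n in atTop, 0 < k n) {ε : ℝ} (hε : 0 < ε) :
    ∃ c : ℝ, 0 < c ∧ ∀ᶠ n : ℕ in atTop, (Measure.pi fun _ : Fin n => R).real
      {z | ε < knnRisk (k n) h z} ≤ 4 * n * Real.exp (-c * k n) := by
  classical
  have : ProperSpace V := FiniteDimensional.proper ℝ V
  obtain ⟨γ, hγ⟩ := exists_card_filter_mem_neighbors_le V
  -- Error budget: `3 (1 + γ) ε₁ = ε / 16`, `3 τ ^ 2 = ε / 16` and `12 M ^ 2 * 2 ε₂ = ε / 8` add up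
  -- to a bias of `ε / 4`. By `knnRisk_le` the risk is at most `2 (ε / 4) + 2 t ^ 2 ≤ ε`. Half of
  -- `ε₁` and of `ε₂` bounds the mean, the other half the deviation from it.
  have hε₁ : 0 < ε / (48 * (1 + γ)) := by positivity
  have hLp : MemLp h (ENNReal.ofReal 2) R.fst :=
    MemLp.of_bound hh.aestronglyMeasurable 1 (ae_of_all _ hh1)
  obtain ⟨g, hg, -⟩ := hLp.exists_boundedContinuous_integral_rpow_sub_le two_pos (half_pos hε₁)
  set ε₁ := ε / (48 * (1 + γ)) with hε₁_def
  set M := ‖g‖ + 1 with hM_def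
  have hM1 : 1 ≤ M := by have := norm_nonneg g; linarith
  have hM0 : 0 < M := by linarith
  have hgM : ∀ x, |g x| ≤ M := fun x => (g.norm_coe_le_norm x).trans (by linarith)
  have hε₂ : 0 < ε / (192 * M ^ 2) := by positivity
  set ε₂ := ε / (192 * M ^ 2) with hε₂_def
  have hτ : 0 < √(ε / 48) := Real.sqrt_pos.2 (by positivity)
  have hτ2 : √(ε / 48) ^ 2 = ε / 48 := Real.sq_sqrt (by positivity)
  set τ := √(ε / 48)
  obtain ⟨W, N, A, η, hW, hWε, hA, hcover, hosc⟩ :=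
    exists_cells R.fst g.continuous (half_pos hε₂) hτ
  have hgm : Measurable g := g.continuous.measurable
  have hψ : Measurable fun z : 𝕏 × ℝ => (h z.1 - g z.1) ^ 2 := by fun_prop
  obtain ⟨c₁, hc₁, hP₁⟩ := exists_pi_real_sum_ge_le R hψ (M := (1 + M) ^ 2) (fun z => by
    rw [abs_of_nonneg (sq_nonneg _), ← sq_abs]
    gcongr
    exact (abs_sub _ _).trans (add_le_add (hh1 _) (hgM _))) (half_pos hε₁)
  have hχ : Measurable fun z : 𝕏 × ℝ => W.indicator (fun _ => (1 : ℝ)) z.1 :=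
    (measurable_const.indicator hW).comp measurable_fst
  obtain ⟨c₂, hc₂, hP₂⟩ := exists_pi_real_sum_ge_le R hχ (M := 1) (fun z => by
    by_cases hz : z.1 ∈ W <;> simp [hz]) (half_pos hε₂)
  have hmean₁ : ∫ z, (h z.1 - g z.1) ^ 2 ∂ R ≤ ε₁ / 2 := by
    refine le_trans (le_of_eq ?_) hg
    rw [Measure.fst, integral_map measurable_fst.aemeasurable]
    · simp
    · have : Measurable fun x => ‖h x - g x‖ ^ (2 : ℝ) := by fun_prop
      exact this.aestronglyMeasurable
  have hmean₂ : ∫ z, W.indicator (fun _ => (1 : ℝ)) z.1 ∂ R ≤ ε₂ / 2 := by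
    refine le_trans (le_of_eq ?_) hWε
    rw [← integral_indicator_one hW, Measure.fst, integral_map measurable_fst.aemeasurable]
    · rfl
    · exact (measurable_one.indicator hW).aestronglyMeasurable
  set t := min 1 (ε / 4) with ht_def
  have ht : 0 < t := lt_min one_pos (by positivity)
  have ht1 : t ≤ 1 := min_le_left _ _
  have ht2 : t ^ 2 ≤ ε / 4 := by
    have : t ≤ ε / 4 := min_le_right _ _
    nlinarith
  set c := min (min c₁ c₂) (t ^ 2 / 16) with hc_def
  have hc : 0 < c := lt_min (lt_min hc₁ hc₂) (by positivity)
  refine ⟨c, hc, ?_⟩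
  -- Below this value of `k / n`, the at most `N * k` points in sparse cells number at most `n *
  -- ε₂`; `N + 1` avoids dividing by zero.
  have hsmall : 0 < ε / (192 * M ^ 2 * (N + 1)) := by positivity
  filter_upwards [hkpos, hk.eventually_lt_const hsmall, hk.eventually_lt_const one_pos,
    eventually_gt_atTop 0] with n hkn hkn' hkn'' hn
  have hn' : (0 : ℝ) < n := by exact_mod_cast hn
  have hn1 : (1 : ℝ) ≤ n := by exact_mod_cast hn
  have hle : k n ≤ n := by
    rw [div_lt_one hn'] at hkn''
    exact_mod_cast hkn''.le
  have hleR : (k n : ℝ) ≤ n := by exact_mod_cast hle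
  have hP₃ := pi_real_abs_knnEstimate_noise_ge_le (n := n) hR hh hh1 hmean hkn hle ht
    (by linarith)
  set S₀ : Set (Fin n → 𝕏 × ℝ) := {z | ¬ Function.Injective fun i => (z i).1}
  set S₁ : Set (Fin n → 𝕏 × ℝ) :=
    {z | n * (∫ a, (h a.1 - g a.1) ^ 2 ∂ R + ε₁ / 2) ≤ ∑ i, (h (z i).1 - g (z i).1) ^ 2}
  set S₂ : Set (Fin n → 𝕏 × ℝ) :=
    {z | n * (∫ a, W.indicator (fun _ => (1 : ℝ)) a.1 ∂ R + ε₂ / 2)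
      ≤ ∑ i, W.indicator (fun _ => (1 : ℝ)) (z i).1}
  set S₃ : Set (Fin n → 𝕏 × ℝ) := {z | ∃ i, t ≤ |knnEstimate (k n) (fun l => (z l).1)
      (fun j => (z j).2 - h (z j).1) (z i).1|}
  have hS₀ : (Measure.pi fun _ : Fin n => R).real S₀ = 0 := by
    rw [measureReal_eq_zero_iff]
    exact ae_injective_fst R hatom
  have hsub : {z : Fin n → 𝕏 × ℝ | ε < knnRisk (k n) h z} ⊆ (S₀ ∪ S₁) ∪ (S₂ ∪ S₃) := by
    intro z hz
    by_contra hnot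
    simp only [Set.mem_union, not_or] at hnot
    obtain ⟨⟨h0, h1⟩, h2, h3⟩ := hnot
    simp only [S₀, S₁, S₂, S₃, Set.mem_ofPred_eq, not_not, not_le, not_exists] at h0 h1 h2 h3 hz
    set x : Fin n → 𝕏 := fun i => (z i).1 with hx
    have hstone : ∀ j, (Finset.univ.filter fun i => j ∈ neighbors (k n) x (x i)).card
        ≤ γ * k n := fun j => by
      simp only [neighbors_subtype]
      exact hγ n (k n) (fun i => (x i : V)) (Subtype.val_injective.comp h0) hkn j
    set B : Finset (Fin n) := (Finset.univ.filter fun i => x i ∈ W) ∪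
      Finset.univ.filter fun i => ∃ c ∈ Finset.range N, x i ∈ A c ∧
        (Finset.univ.filter fun j => x j ∈ A c).card < k n with hB
    have hBosc : ∀ i ∉ B, ∀ j ∈ neighbors (k n) x (x i), |g (x i) - g (x j)| ≤ τ := by
      intro i hi j hj
      simp only [hB, Finset.mem_union, Finset.mem_filter, Finset.mem_univ, true_and, not_or,
        not_exists, not_and, not_lt] at hi
      obtain ⟨c, hc, hic⟩ := hcover _ hi.1
      exact hosc _ hi.1 _ (dist_le_of_mem_neighbors (hA c) hic (hi.2 c hc hic) hj)
    have hbias := sum_sq_sub_knnEstimate_le hkn hle x hstone h g hgM B hBosc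
    have hind : ∑ i, W.indicator (fun _ => (1 : ℝ)) (x i)
        = (Finset.univ.filter fun i => x i ∈ W).card := by
      simp [Set.indicator_apply, Finset.sum_boole]
    have hBcard : (B.card : ℝ) ≤ n * ε₂ + N * k n := by
      have h4 := (Finset.card_union_le (Finset.univ.filter fun i => x i ∈ W)
        (Finset.univ.filter fun i => ∃ c ∈ Finset.range N, x i ∈ A c ∧
        (Finset.univ.filter fun j => x j ∈ A c).card < k n)).trans
        (add_le_add le_rfl (card_sparse_le (Finset.range N) A (k n) x))
      rw [Finset.card_range] at h4
      have h5 : (B.card : ℝ) ≤ (Finset.univ.filter fun i => x i ∈ W).card + N * k n := by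
        exact_mod_cast h4
      have h6 : ((Finset.univ.filter fun i => x i ∈ W).card : ℝ) ≤ n * ε₂ := by
        rw [← hind]
        refine h2.le.trans ?_
        gcongr
        linarith
      linarith
    have hfit : ∑ j, (h (x j) - g (x j)) ^ 2 ≤ n * ε₁ := by
      refine h1.le.trans ?_
      gcongr
      linarith
    have hNk : N * k n ≤ n * ε₂ := by
      rw [div_lt_iff₀ hn'] at hkn'
      calc (N : ℝ) * k n ≤ (N + 1) * (ε / (192 * M ^ 2 * (N + 1)) * n) := by
            gcongr
            linarith
        _ = n * ε₂ := by rw [hε₂_def]; field_simp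
    have hb1 : 3 * (1 + (γ : ℝ)) * ∑ j, (h (x j) - g (x j)) ^ 2 ≤ n * (ε / 16) := by
      calc _ ≤ 3 * (1 + (γ : ℝ)) * (n * ε₁) := by gcongr
        _ = n * (ε / 16) := by rw [hε₁_def]; field_simp; norm_num
    have hb2 : 12 * M ^ 2 * B.card ≤ n * (ε / 8) := by
      calc _ ≤ 12 * M ^ 2 * (n * ε₂ + n * ε₂) := by gcongr; linarith
        _ = n * (ε / 8) := by rw [hε₂_def]; field_simp; norm_num
    rw [hτ2] at hbias
    have hbias' : ∑ i, (h (x i) - knnEstimate (k n) x (fun j => h (x j)) (x i)) ^ 2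
        ≤ n * (ε / 4) := by linarith
    have := knnRisk_le (k n) h hn z (fun i => (h3 i).le) hbias'
    linarith
  -- The Hoeffding terms decay in `n ≥ k`; they are weakened so as to merge with the noise term.
  have hexp : ∀ c' : ℝ, c ≤ c' → Real.exp (-c' * n) ≤ n * Real.exp (-c * k n) := fun c' hc' => by
    have : Real.exp (-c' * n) ≤ Real.exp (-c * k n) := by
      refine Real.exp_le_exp.2 ?_
      have : c * k n ≤ c' * n := mul_le_mul hc' hleR (by positivity) (hc.le.trans hc')
      linarith
    exact this.trans (le_mul_of_one_le_left (Real.exp_pos _).le hn1)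
  have hexp3 : 2 * n * Real.exp (-(t ^ 2 / 16) * k n) ≤ 2 * n * Real.exp (-c * k n) := by
    gcongr
    exact min_le_right _ _
  have e1 := (hP₁ n).trans (hexp c₁ ((min_le_left _ _).trans (min_le_left _ _)))
  have e2 := (hP₂ n).trans (hexp c₂ ((min_le_left _ _).trans (min_le_right _ _)))
  have e3 := hP₃.trans hexp3
  calc _ ≤ _ := measureReal_mono hsub
    _ ≤ (0 + n * Real.exp (-c * k n)) +
          (n * Real.exp (-c * k n) + 2 * n * Real.exp (-c * k n)) :=
        (measureReal_union_le _ _).trans (add_le_add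
          ((measureReal_union_le _ _).trans (add_le_add hS₀.le e1))
          ((measureReal_union_le _ _).trans (add_le_add e2 e3)))
    _ = _ := by ring

/-! ### Conditional means of the original and resampled labels -/

section ConditionalMean

variable {E : Type*} [MeasurableSpace E]

theorem hasConditionalMean_of_isRegressionFunction {Q : Measure (E × ℝ)} [IsProbabilityMeasure Q]
    (hQ : ∀ᵐ z ∂Q, |z.2| ≤ 1) {h : E → ℝ} (hh1 : ∀ x, |h x| ≤ 1)
    (hreg : IsRegressionFunction Q h) : HasConditionalMean Q h := by
  rintro φ hφ ⟨C, hC⟩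
  obtain ⟨hh, hce⟩ := hreg
  have hm : MeasurableSpace.comap (Prod.fst : E × ℝ → E) inferInstance ≤ Prod.instMeasurableSpace :=
    measurable_fst.comap_le
  have hφm : StronglyMeasurable[MeasurableSpace.comap (Prod.fst : E × ℝ → E) inferInstance]
      fun z : E × ℝ => φ z.1 :=
    (hφ.comp (comap_measurable Prod.fst)).stronglyMeasurable
  have hi2 : Integrable (fun z : E × ℝ => z.2) Q :=
    Integrable.of_bound measurable_snd.aestronglyMeasurable 1 hQ
  have hi : Integrable ((fun z : E × ℝ => φ z.1) * fun z : E × ℝ => z.2) Q :=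
    hi2.bdd_mul (c := C) (hφ.comp measurable_fst).aestronglyMeasurable (ae_of_all _ fun z => hC z.1)
  have hi' : Integrable (fun z : E × ℝ => φ z.1 * h z.1) Q :=
    Integrable.of_bound (by fun_prop) (C * 1) (ae_of_all _ fun z => by
      have := (abs_nonneg _).trans (hC z.1)
      rw [Real.norm_eq_abs, abs_mul]
      gcongr
      · exact hC _
      · exact hh1 _)
  have hpull := condExp_mul_of_stronglyMeasurable_left hφm hi hi2
  have : ∫ z : E × ℝ, φ z.1 * z.2 ∂Q = ∫ z : E × ℝ, φ z.1 * h z.1 ∂Q := by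
    calc _ = ∫ z, ((fun z : E × ℝ => φ z.1) * fun z : E × ℝ => z.2) z ∂Q := rfl
      _ = _ := (integral_condExp hm).symm
      _ = _ := integral_congr_ae (by
        filter_upwards [hpull, hce] with z h1 h2
        rw [h1, Pi.mul_apply, h2])
  simp only [mul_sub]
  refine (integral_sub hi hi').trans ?_
  exact sub_eq_zero.2 this

instance : IsProbabilityMeasure uniformPM :=
  cond_isProbabilityMeasure_of_finite (by simp) (by simp)

instance (m : ℕ) : IsProbabilityMeasure (uniformPerm m) :=
  PMF.toMeasure.isProbabilityMeasure _

theorem measurable_sgn : Measurable sgn :=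
  Measurable.ite measurableSet_Ici measurable_const measurable_const

theorem abs_sgn_le (t : ℝ) : |sgn t| ≤ 1 := by
  unfold sgn; split_ifs <;> simp

/-- The sign is `+1` on an interval of length `1 + a` and `-1` on one of length `1 - a`; the
difference `2 * a` is divided by the total length `2`. -/
theorem integral_sgn_add_uniformPM {a : ℝ} (ha : a ∈ Set.Icc (-1 : ℝ) 1) :
    ∫ u, sgn (a + u) ∂uniformPM = a := by
  have hint : ∀ b c : ℝ, IntervalIntegrable (fun u => sgn (a + u)) volume b c := fun b c => by
    refine (intervalIntegrable_const (c := (1 : ℝ))).mono_fun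
      (measurable_sgn.comp (measurable_const_add a)).aestronglyMeasurable (ae_of_all _ fun u => ?_)
    simpa using abs_sgn_le (a + u)
  have h1 : ∫ u in (-1 : ℝ)..(-a), sgn (a + u) = ∫ u in (-1 : ℝ)..(-a), (-1 : ℝ) := by
    refine intervalIntegral.integral_congr_ae ?_
    -- At the endpoint `u = -a` the value is `sgn 0 = 1`, so the integrands agree only almost
    -- everywhere.
    have : ∀ᵐ u : ℝ, u ≠ -a := by simp [ae_iff]
    filter_upwards [this] with u hu hmem
    rw [Set.uIoc_of_le (by linarith [ha.2])] at hmem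
    have : u < -a := lt_of_le_of_ne hmem.2 hu
    simp only [sgn]
    rw [if_neg (by linarith)]
  have h2 : ∫ u in (-a)..1, sgn (a + u) = ∫ u in (-a)..1, (1 : ℝ) := by
    refine intervalIntegral.integral_congr fun u hmem => ?_
    rw [Set.uIcc_of_le (by linarith [ha.1])] at hmem
    simp only [sgn]
    rw [if_pos (by linarith [hmem.1])]
  have h3 : ∫ u in Set.Icc (-1 : ℝ) 1, sgn (a + u) = 2 * a := by
    rw [integral_Icc_eq_integral_Ioc, ← intervalIntegral.integral_of_le (by norm_num),
      ← intervalIntegral.integral_add_adjacent_intervals (hint _ (-a)) (hint _ _), h1, h2]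
    simp only [intervalIntegral.integral_const, smul_eq_mul]
    ring
  rw [uniformPM, ProbabilityTheory.cond, integral_smul_measure, h3]
  simp only [Real.volume_Icc, smul_eq_mul]
  norm_num
  ring

/-- The law of an input together with a label resampled from the candidate `g`. -/
noncomputable def resampledLaw (Q : Measure (E × ℝ)) (g : E → ℝ) : Measure (E × ℝ) :=
  (Q.prod uniformPM).map fun p => (p.1.1, sgn (g p.1.1 + p.2))

theorem measurable_resample {g : E → ℝ} (hg : Measurable g) :
    Measurable fun p : (E × ℝ) × ℝ => (p.1.1, sgn (g p.1.1 + p.2)) :=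
  (measurable_fst.comp measurable_fst).prodMk (measurable_sgn.comp (by fun_prop))

theorem isProbabilityMeasure_resampledLaw (Q : Measure (E × ℝ)) [IsProbabilityMeasure Q]
    {g : E → ℝ} (hg : Measurable g) : IsProbabilityMeasure (resampledLaw Q g) :=
  Measure.isProbabilityMeasure_map (measurable_resample hg).aemeasurable

theorem fst_resampledLaw (Q : Measure (E × ℝ)) [IsProbabilityMeasure Q] {g : E → ℝ}
    (hg : Measurable g) : (resampledLaw Q g).fst = Q.fst := by
  rw [Measure.fst, resampledLaw, Measure.map_map measurable_fst (measurable_resample hg)]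
  have : (Prod.fst ∘ fun p : (E × ℝ) × ℝ => (p.1.1, sgn (g p.1.1 + p.2))) = Prod.fst ∘ Prod.fst :=
    rfl
  rw [this, ← Measure.map_map measurable_fst measurable_fst, ← Measure.fst, ← Measure.fst,
    Measure.fst_prod]

theorem ae_abs_snd_resampledLaw_le (Q : Measure (E × ℝ)) {g : E → ℝ} (hg : Measurable g) :
    ∀ᵐ z ∂resampledLaw Q g, |z.2| ≤ 1 := by
  rw [resampledLaw, ae_map_iff (measurable_resample hg).aemeasurable
    (measurableSet_le (by fun_prop) measurable_const)]
  exact ae_of_all _ fun p => abs_sgn_le _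

theorem hasConditionalMean_resampledLaw (Q : Measure (E × ℝ)) [IsProbabilityMeasure Q] {g : E → ℝ}
    (hg : Measurable g) (hg1 : ∀ x, g x ∈ Set.Icc (-1 : ℝ) 1) :
    HasConditionalMean (resampledLaw Q g) g := by
  rintro φ hφ ⟨C, hC⟩
  have hsm : Measurable fun p : (E × ℝ) × ℝ => sgn (g p.1.1 + p.2) :=
    (measurable_resample hg).snd
  rw [resampledLaw, integral_map (measurable_resample hg).aemeasurable (by fun_prop),
    integral_prod]
  · refine integral_eq_zero_of_ae (ae_of_all _ fun z => ?_)
    have hi : Integrable (fun u => sgn (g z.1 + u)) uniformPM :=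
      Integrable.of_bound (measurable_sgn.comp (measurable_const_add _)).aestronglyMeasurable 1
        (ae_of_all _ fun u => abs_sgn_le _)
    simp only [Pi.zero_apply]
    rw [integral_const_mul, integral_sub hi (integrable_const _),
      integral_sgn_add_uniformPM (hg1 _)]
    simp
  · refine Integrable.of_bound (by fun_prop) (C * 2) (ae_of_all _ fun p => ?_)
    have := (abs_nonneg _).trans (hC p.1.1)
    rw [Real.norm_eq_abs, abs_mul]
    gcongr
    · exact hC _
    · exact (abs_sub _ _).trans (by linarith [abs_sgn_le (g p.1.1 + p.2), abs_le.2 (hg1 p.1.1)])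

end ConditionalMean

/-! ### Laws of the datasets; absence of atoms -/

section Experiment

variable {E : Type*} [MeasurableSpace E] {n m : ℕ} [NeZero m]

/-- Pairing the sample with the independent uniform variables index by index shows that each
resampled dataset is itself an i.i.d. sample, so the consistency theorem applies to it. Datasets
with different `j` share their inputs; only the individual laws are needed for a union bound. -/
theorem measurePreserving_resampledSample (Q : Measure (E × ℝ)) [IsProbabilityMeasure Q]
    {g : E → ℝ} (hg : Measurable g) (j : {j : Fin m // j ≠ 0}) :
    MeasurePreserving (fun (w : (Fin n → E × ℝ) × (Fin n → {j : Fin m // j ≠ 0} → ℝ) ×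
        Equiv.Perm (Fin m)) (i : Fin n) => ((w.1 i).1, sgn (g (w.1 i).1 + w.2.1 i j)))
      (experimentLaw Q n m) (Measure.pi fun _ => resampledLaw Q g) := by
  have := isProbabilityMeasure_resampledLaw Q hg
  have h1 : MeasurePreserving (Prod.map (id : (Fin n → E × ℝ) → _)
      (Prod.fst : (Fin n → {j : Fin m // j ≠ 0} → ℝ) × Equiv.Perm (Fin m) → _))
      (experimentLaw Q n m) ((Measure.pi fun _ => Q).prod
        (Measure.pi fun _ => Measure.pi fun _ => uniformPM)) :=
    (MeasurePreserving.id _).prod measurePreserving_fst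
  have h2 := (measurePreserving_arrowProdEquivProdArrow (E × ℝ) ({j : Fin m // j ≠ 0} → ℝ) (Fin n)
    (fun _ => Q) (fun _ => Measure.pi fun _ => uniformPM)).symm
  have h3 : MeasurePreserving (fun p : (E × ℝ) × ({j : Fin m // j ≠ 0} → ℝ) =>
      (p.1.1, sgn (g p.1.1 + p.2 j))) (Q.prod (Measure.pi fun _ => uniformPM))
      (resampledLaw Q g) :=
    (measurable_resample hg).measurePreserving _ |>.comp
      ((MeasurePreserving.id _).prod
        (measurePreserving_eval (fun _ : {j : Fin m // j ≠ 0} => uniformPM) j))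
  exact (measurePreserving_pi _ _ fun _ : Fin n => h3).comp (h2.comp h1)

theorem measurePreserving_originalSample (Q : Measure (E × ℝ)) [IsProbabilityMeasure Q] :
    MeasurePreserving Prod.fst (experimentLaw Q n m) (Measure.pi fun _ => Q) :=
  measurePreserving_fst

/-- The inequality holds for arbitrary sets, so the events on `knnRisk` need not be shown
measurable. -/
theorem measureReal_preimage_le {α β : Type*} [MeasurableSpace α] [MeasurableSpace β]
    {μ : Measure α} {ν : Measure β} [IsFiniteMeasure ν] {T : α → β}
    (hT : AEMeasurable T μ) (hmap : μ.map T = ν) (s : Set β) :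
    μ.real (T ⁻¹' s) ≤ ν.real s := by
  subst hmap
  exact ENNReal.toReal_mono (measure_ne_top _ _) (Measure.le_map_apply hT s)

end Experiment

/-- If `a` had positive mass, three independent copies would all equal `a` with positive
probability, and both distances would be zero. -/
theorem measure_singleton_eq_zero_of_norm_sub_ne {V : Type*} [NormedAddCommGroup V]
    [MeasurableSpace V] {𝕏 : Set V} (ν : Measure 𝕏) [IsProbabilityMeasure ν]
    (h : ∀ᵐ p ∂(ν.prod (ν.prod ν)), ‖(p.1 : V) - p.2.1‖ ≠ ‖(p.1 : V) - p.2.2‖) (a : 𝕏) :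
    ν {a} = 0 := by
  have h0 : (ν.prod (ν.prod ν)) ({a} ×ˢ ({a} ×ˢ {a})) = 0 := by
    refine measure_mono_null ?_ (ae_iff.1 h)
    rintro ⟨p, q, r⟩ ⟨hp, hq, hr⟩
    simp only [Set.mem_singleton_iff] at hp hq hr
    simp [hp, hq, hr]
  rw [Measure.prod_prod, Measure.prod_prod] at h0
  simpa using h0

/-! ### Comparison of rates -/

section Asymptotics

variable {k : ℕ → ℕ}

theorem eventually_le_sq_of_tendsto (hk' : ∃ δ : ℝ, 0 < δ ∧
    Tendsto (fun n : ℕ => (k n : ℝ) ^ 2 / (n : ℝ) ^ (1 + δ)) atTop atTop) :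
    ∀ᶠ n : ℕ in atTop, (n : ℝ) ≤ (k n : ℝ) ^ 2 := by
  obtain ⟨δ, hδ, h⟩ := hk'
  filter_upwards [h.eventually_ge_atTop 1, eventually_ge_atTop 1] with n hn hn1
  have hn1' : (1 : ℝ) ≤ n := by exact_mod_cast hn1
  have hpos : 0 < (n : ℝ) ^ (1 + δ) := by positivity
  rw [le_div_iff₀ hpos, one_mul] at hn
  refine le_trans ?_ hn
  calc (n : ℝ) = (n : ℝ) ^ (1 : ℝ) := (Real.rpow_one _).symm
    _ ≤ _ := Real.rpow_le_rpow_of_exponent_le hn1' (by linarith)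

/-- Half of the exponent `c k` absorbs `4 n ≤ 4 k ^ 2`; the other half dominates `k ^ 2 * l / n`,
which is `o(k)` because `k / n → 0`. -/
theorem eventually_mul_exp_neg_le (hk : Tendsto (fun n : ℕ => (k n : ℝ) / (n : ℝ)) atTop (𝓝 0))
    (hsq : ∀ᶠ n : ℕ in atTop, (n : ℝ) ≤ (k n : ℝ) ^ 2) {c l : ℝ} (hc : 0 < c) (hl : 0 ≤ l) :
    ∀ᶠ n : ℕ in atTop, 4 * n * Real.exp (-c * k n) ≤ Real.exp (-((k n : ℝ) ^ 2 * l / n)) := by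
  have hktop : Tendsto (fun n => (k n : ℝ)) atTop atTop := by
    refine tendsto_atTop_mono' _ ?_ (Real.tendsto_sqrt_atTop.comp tendsto_natCast_atTop_atTop)
    filter_upwards [hsq] with n hn
    exact Real.sqrt_le_iff.2 ⟨by positivity, hn⟩
  have ho := ((isLittleO_pow_exp_pos_mul_atTop 2 (half_pos hc)).comp_tendsto hktop).bound
    (by norm_num : (0 : ℝ) < 1 / 4)
  have hsmall : 0 < c / (2 * (l + 1)) := by positivity
  filter_upwards [ho, hsq, hk.eventually_lt_const hsmall, eventually_gt_atTop 0]
    with n h1 h2 h3 hn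
  have hn' : (0 : ℝ) < n := by exact_mod_cast hn
  simp only [Function.comp_apply, Real.norm_eq_abs, abs_of_pos (Real.exp_pos _),
    abs_of_nonneg (sq_nonneg (k n : ℝ))] at h1
  have h4 : (k n : ℝ) ^ 2 * l / n ≤ c / 2 * k n := by
    calc (k n : ℝ) ^ 2 * l / n = (k n / n) * (k n * l) := by ring
      _ ≤ (c / (2 * (l + 1))) * (k n * (l + 1)) := by gcongr; linarith
      _ = c / 2 * k n := by field_simp
  calc 4 * n * Real.exp (-c * k n) ≤ Real.exp (c / 2 * k n) * Real.exp (-c * k n) := by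
        gcongr; linarith
    _ = Real.exp (-(c / 2 * k n)) := by rw [← Real.exp_add]; congr 1; ring
    _ ≤ _ := Real.exp_le_exp.2 (by linarith)

end Asymptotics

/-! ### From reference variables to the rank -/

section Rank

variable {E : Type*} [PseudoMetricSpace E] {n m : ℕ} [NeZero m]

theorem refVar_zero_eq (k : ℕ) (g : E → ℝ) (z : Fin n → E × ℝ)
    (u : Fin n → {j : Fin m // j ≠ 0} → ℝ) :
    refVar k g (fun i => (z i).1) (fun i => (z i).2) u 0 = knnRisk k g z := by
  have h : labels g (fun i => (z i).1) (fun i => (z i).2) u 0 = fun l => (z l).2 := by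
    ext i; simp [labels]
  simp only [refVar, knnRisk, h]

theorem refVar_of_ne_zero_eq (k : ℕ) (g : E → ℝ) (x : Fin n → E) (y : Fin n → ℝ)
    (u : Fin n → {j : Fin m // j ≠ 0} → ℝ) (j : {j : Fin m // j ≠ 0}) :
    refVar k g x y u j = knnRisk k g fun i => (x i, sgn (g (x i) + u i j)) := by
  have h : labels g x y u j = fun i => sgn (g (x i) + u i j) := by
    ext i; simp [labels, j.2]
  simp only [refVar, knnRisk, h]

/-- Triangle inequality through the common estimate: if it is close to `h` and `g` is far from `h`,
the risk of `g` cannot be small. This yields the lower bound on `Z⁽⁰⁾`. -/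
theorem sum_sq_sub_le_knnRisk_add (k : ℕ) (g h : E → ℝ) (hn : 0 < n) (z : Fin n → E × ℝ) :
    ∑ i, (g (z i).1 - h (z i).1) ^ 2 ≤ n * (2 * knnRisk k g z + 2 * knnRisk k h z) := by
  have hn' : (n : ℝ) ≠ 0 := by exact_mod_cast hn.ne'
  have : (n : ℝ) * (2 * knnRisk k g z + 2 * knnRisk k h z) =
      ∑ i, (2 * (g (z i).1 - knnEstimate k (fun l => (z l).1) (fun l => (z l).2) (z i).1) ^ 2 +
        2 * (h (z i).1 - knnEstimate k (fun l => (z l).1) (fun l => (z l).2) (z i).1) ^ 2) := by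
    rw [Finset.sum_add_distrib, ← Finset.mul_sum, ← Finset.mul_sum]
    unfold knnRisk
    field_simp
  rw [this]
  refine Finset.sum_le_sum fun i _ => ?_
  set a := g (z i).1
  set b := h (z i).1
  set p := knnEstimate k (fun l => (z l).1) (fun l => (z l).2) (z i).1
  nlinarith [sq_nonneg ((a - p) + (b - p))]

-- With strict inequalities the tie-breaking permutation plays no role, and all `m - 1` indicators
-- equal `1`.
open Classical in
theorem rank_eq_of_forall_lt {k : ℕ} {g : E → ℝ} {x : Fin n → E} {y : Fin n → ℝ}
    {u : Fin n → {j : Fin m // j ≠ 0} → ℝ} (p : Equiv.Perm (Fin m))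
    (h : ∀ j : Fin m, j ≠ 0 → refVar k g x y u j < refVar k g x y u 0) :
    rank k g x y u p = m := by
  unfold rank
  have h1 : ∀ j ∈ Finset.univ.filter (fun j : Fin m => j ≠ 0),
      (if Prec (refVar k g x y u) p j 0 then 1 else 0) = 1 := fun j hj =>
    if_pos (Or.inl (h j (by simpa using hj)))
  rw [Finset.sum_congr rfl h1]
  have := NeZero.pos m
  rw [Finset.sum_const, Finset.filter_ne' Finset.univ (0 : Fin m),
    Finset.card_erase_of_mem (Finset.mem_univ _)]
  simp
  omega

end Rank

end KNNResampling

/-! ### The main theorem -/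

open KNNResampling

theorem theorem5 {d : ℕ} {𝕏 : Set (EuclideanSpace ℝ (Fin d))} {Θ : Type*}
    -- the distribution of `(X, Y)`, with labels in `{1, -1}`
    (Q : Measure (𝕏 × ℝ)) [IsProbabilityMeasure Q]
    (hY : ∀ᵐ z ∂Q, z.2 = 1 ∨ z.2 = -1)
    -- the model class contains the regression function, and the parametrization is injective
    (f : Θ → 𝕏 → ℝ) (hf_meas : ∀ θ, Measurable (f θ))
    (hf_range : ∀ θ x, f θ x ∈ Set.Icc (-1 : ℝ) 1)
    (hf_inj : ∀ θ₁ θ₂, θ₁ ≠ θ₂ → KNNResampling.sqDistQ Q (f θ₁) (f θ₂) ≠ 0)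
    (θstar : Θ) (hstar : KNNResampling.IsRegressionFunction Q (f θstar))
    -- the parameters of the method
    (m q : ℕ) [NeZero m] (hq : q < m) (k : ℕ → ℕ)
    (hk : Tendsto (fun n : ℕ => (k n : ℝ) / (n : ℝ)) atTop (𝓝 0))
    (hk' : ∃ δ : ℝ, 0 < δ ∧
      Tendsto (fun n : ℕ => (k n : ℝ) ^ 2 / (n : ℝ) ^ (1 + δ)) atTop atTop)
    -- distances from `X` to independent copies of `X` are almost surely different
    (hties : ∀ᵐ p ∂(Q.fst.prod (Q.fst.prod Q.fst)),
      ‖(p.1 : EuclideanSpace ℝ (Fin d)) - p.2.1‖ ≠ ‖(p.1 : EuclideanSpace ℝ (Fin d)) - p.2.2‖)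
    (θ : Θ) (hθ : θ ≠ θstar) :
    ∃ N₀ : ℕ, ∀ n : ℕ, N₀ ≤ n →
      ∀ {Ω : Type*} [MeasurableSpace Ω] (P : Measure Ω) [IsProbabilityMeasure P]
        (X : Fin n → Ω → 𝕏) (Y : Fin n → Ω → ℝ)
        (U : Fin n → {j : Fin m // j ≠ 0} → Ω → ℝ) (π : Ω → Equiv.Perm (Fin m)),
        HasLaw
          (fun ω => ((fun i => (X i ω, Y i ω)), (fun i j => U i j ω), π ω))
          (KNNResampling.experimentLaw Q n m) P →
        1 - (4 + 2 * ((m : ℝ) - 1)) *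
            Real.exp (-((k n : ℝ) ^ 2 *
              (KNNResampling.distQ Q (f θ) (f θstar) ^ 4 / (2 * 48 ^ 2)) / (n : ℝ)))
          ≤ P.real {ω | θ ∉ KNNResampling.confidenceRegion f q (k n)
              (fun i => X i ω) (fun i => Y i ω) (fun i j => U i j ω) (π ω)} := by
  set l := distQ Q (f θ) (f θstar) ^ 4 / (2 * 48 ^ 2) with hl_def
  have hl : 0 ≤ l := by positivity
  have hQ1 : ∀ᵐ z ∂Q, |z.2| ≤ 1 := by
    filter_upwards [hY] with z hz
    rcases hz with hz | hz <;> simp [hz]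
  have habs : ∀ θ x, |f θ x| ≤ 1 := fun θ x => abs_le.2 (hf_range θ x)
  have hatom := measure_singleton_eq_zero_of_norm_sub_ne Q.fst hties
  have hs : 0 < sqDistQ Q (f θ) (f θstar) :=
    lt_of_le_of_ne (integral_nonneg fun x => sq_nonneg _) (hf_inj _ _ hθ).symm
  set s := sqDistQ Q (f θ) (f θstar) with hs_def
  have hsq := eventually_le_sq_of_tendsto hk'
  have hkpos : ∀ᶠ n in atTop, 0 < k n := by
    filter_upwards [hsq, eventually_gt_atTop 0] with n hn hn0
    rcases (k n).eq_zero_or_pos with h | h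
    · rw [h] at hn
      have : (0 : ℝ) < n := by exact_mod_cast hn0
      norm_num at hn
      omega
    · exact h
  -- Threshold separating the reference variables: off the exceptional events `Z⁽ʲ⁾ ≤ s / 16` for `j
  -- ≠ 0`, while `Z⁽⁰⁾ > 3 * s / 16`.
  have hs16 : 0 < s / 16 := by positivity
  obtain ⟨c₀, hc₀, h₀⟩ := exists_knnRisk_tail_le hatom hQ1 (hf_meas θstar) (habs θstar)
    (hasConditionalMean_of_isRegressionFunction hQ1 (habs θstar) hstar) hk hkpos hs16
  have := isProbabilityMeasure_resampledLaw Q (hf_meas θ)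
  obtain ⟨c₁, hc₁, h₁⟩ := exists_knnRisk_tail_le (R := resampledLaw Q (f θ))
    (by rw [fst_resampledLaw Q (hf_meas θ)]; exact hatom)
    (ae_abs_snd_resampledLaw_le Q (hf_meas θ)) (hf_meas θ) (habs θ)
    (hasConditionalMean_resampledLaw Q (hf_meas θ) (hf_range θ)) hk hkpos hs16
  -- The sign turns the upper-tail Hoeffding bound into a lower-tail bound for the empirical squared
  -- distance.
  have hφ : Measurable fun z : 𝕏 × ℝ => -(f θ z.1 - f θstar z.1) ^ 2 := by
    have h1 := hf_meas θ
    have h2 := hf_meas θstar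
    fun_prop
  obtain ⟨c₂, hc₂, h₂⟩ := exists_pi_real_sum_ge_le Q hφ (M := 4) (fun z => by
    have h3 : |f θ z.1 - f θstar z.1| ≤ 2 :=
      (abs_sub _ _).trans (by linarith [habs θ z.1, habs θstar z.1])
    have h4 := sq_le_sq' (abs_le.1 h3).1 (abs_le.1 h3).2
    rw [abs_neg, abs_of_nonneg (sq_nonneg _)]
    linarith) (half_pos hs)
  have hmean : ∫ z : 𝕏 × ℝ, -(f θ z.1 - f θstar z.1) ^ 2 ∂Q = -s := by
    have h1 := hf_meas θ
    have h2 := hf_meas θstar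
    rw [integral_neg, hs_def, sqDistQ, Measure.fst, integral_map measurable_fst.aemeasurable]
    have : Measurable fun x => (f θ x - f θstar x) ^ 2 := by fun_prop
    exact this.aestronglyMeasurable
  rw [hmean] at h₂
  refine eventually_atTop.1 ?_
  filter_upwards [h₀, h₁, eventually_mul_exp_neg_le hk hsq hc₀ hl,
    eventually_mul_exp_neg_le hk hsq hc₁ hl, eventually_mul_exp_neg_le hk hsq hc₂ hl,
    hk.eventually_lt_const one_pos, eventually_gt_atTop 0] with n h₀ h₁ e₀ e₁ e₂ hkn hn
  intro Ω _ P _ X Y U π hlaw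
  have hn' : (0 : ℝ) < n := by exact_mod_cast hn
  have hn1 : (1 : ℝ) ≤ n := by exact_mod_cast hn
  have hle : (k n : ℝ) ≤ n := by rw [div_lt_one hn'] at hkn; exact hkn.le
  set b := Real.exp (-((k n : ℝ) ^ 2 * l / n)) with hb_def
  have hb : 0 < b := Real.exp_pos _
  have e₂' : Real.exp (-c₂ * n) ≤ b := by
    have h1 : Real.exp (-c₂ * n) ≤ Real.exp (-c₂ * k n) := Real.exp_le_exp.2 (by nlinarith)
    have h2 : Real.exp (-c₂ * k n) ≤ 4 * n * Real.exp (-c₂ * k n) :=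
      le_mul_of_one_le_left (Real.exp_pos _).le (by linarith)
    linarith
  set T : Ω → (Fin n → 𝕏 × ℝ) × (Fin n → {j : Fin m // j ≠ 0} → ℝ) × Equiv.Perm (Fin m) :=
    fun ω => ((fun i => (X i ω, Y i ω)), (fun i j => U i j ω), π ω) with hT
  have hprob : IsProbabilityMeasure (experimentLaw Q n m) := by
    unfold experimentLaw; infer_instance
  have hTm := hlaw.aemeasurable
  have hTmap := hlaw.map_eq
  have hfst := measurePreserving_originalSample (n := n) (m := m) Q
  set S₀ : Set Ω := T ⁻¹' (Prod.fst ⁻¹' {z | s / 16 < knnRisk (k n) (f θstar) z})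
  set S₁ : {j : Fin m // j ≠ 0} → Set Ω := fun j => T ⁻¹'
    ((fun (w : (Fin n → 𝕏 × ℝ) × (Fin n → {j : Fin m // j ≠ 0} → ℝ) × Equiv.Perm (Fin m))
      (i : Fin n) => ((w.1 i).1, sgn (f θ (w.1 i).1 + w.2.1 i j))) ⁻¹'
        {z | s / 16 < knnRisk (k n) (f θ) z})
  set S₂ : Set Ω := T ⁻¹' (Prod.fst ⁻¹' {z | n * (-s + s / 2) ≤
    ∑ i, -(f θ (z i).1 - f θstar (z i).1) ^ 2})
  have p₀ : P.real S₀ ≤ b := (measureReal_preimage_le hTm hTmap _).trans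
    ((measureReal_preimage_le hfst.measurable.aemeasurable hfst.map_eq _).trans (h₀.trans e₀))
  have p₁ : ∀ j, P.real (S₁ j) ≤ b := fun j => by
    have hres := measurePreserving_resampledSample (n := n) (m := m) Q (hf_meas θ) j
    exact (measureReal_preimage_le hTm hTmap _).trans
      ((measureReal_preimage_le hres.measurable.aemeasurable hres.map_eq _).trans (h₁.trans e₁))
  have p₂ : P.real S₂ ≤ b := (measureReal_preimage_le hTm hTmap _).trans
    ((measureReal_preimage_le hfst.measurable.aemeasurable hfst.map_eq _).trans
      ((h₂ n).trans e₂'))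
  have p₁' : P.real (⋃ j, S₁ j) ≤ (m - 1) * b := by
    refine (measureReal_iUnion_fintype_le _).trans
      ((Finset.sum_le_sum fun j _ => p₁ j).trans_eq ?_)
    have hm := NeZero.pos m
    rw [Finset.sum_const, Finset.card_univ, Fintype.card_subtype_compl, nsmul_eq_mul]
    simp [Nat.cast_sub (Nat.one_le_iff_ne_zero.2 hm.ne')]
  set G : Set Ω := {ω | θ ∉ confidenceRegion f q (k n)
    (fun i => X i ω) (fun i => Y i ω) (fun i j => U i j ω) (π ω)}
  -- Covering the whole space by the exceptional events and the rejection event bounds the latter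
  -- from below by subadditivity alone, without measurability.
  have hcover : (Set.univ : Set Ω) ⊆ (S₀ ∪ S₂) ∪ (⋃ j, S₁ j) ∪ G := by
    intro ω _
    by_contra hnot
    simp only [Set.mem_union, Set.mem_iUnion, not_or, not_exists] at hnot
    obtain ⟨⟨⟨n0, n2⟩, n1⟩, nG⟩ := hnot
    simp only [S₀, S₁, S₂, Set.mem_preimage, Set.mem_ofPred_eq, not_lt, not_le, hT] at n0 n1 n2
    refine nG ?_
    have hdec := sum_sq_sub_le_knnRisk_add (k n) (f θ) (f θstar) hn (fun i => (X i ω, Y i ω))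
    rw [Finset.sum_neg_distrib] at n2
    have hlow : s / 16 < knnRisk (k n) (f θ) (fun i => (X i ω, Y i ω)) := by
      -- Off `S₂` the empirical squared distance exceeds `s / 2`, and off `S₀` the risk of `f θstar`
      -- is at most `s / 16`; hence `2 * Z⁽⁰⁾ > s / 2 - s / 8`.
      have h5 : n * (s / 2) < n * (2 * knnRisk (k n) (f θ) (fun i => (X i ω, Y i ω)) +
        2 * knnRisk (k n) (f θstar) (fun i => (X i ω, Y i ω))) := by linarith
      have h6 := lt_of_mul_lt_mul_left h5 hn'.le
      linarith
    have hrank := rank_eq_of_forall_lt (k := k n) (g := f θ) (x := fun i => X i ω)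
      (y := fun i => Y i ω) (u := fun i j => U i j ω) (π ω) fun j hj => by
        rw [refVar_of_ne_zero_eq _ _ _ _ _ ⟨j, hj⟩,
          refVar_zero_eq (k n) (f θ) (fun i => (X i ω, Y i ω))]
        exact (n1 ⟨j, hj⟩).trans_lt hlow
    show ¬ (rank _ _ _ _ _ _ ≤ q)
    rw [hrank]
    omega
  have htot : 1 ≤ (b + b + (m - 1) * b) + P.real G := by
    calc (1 : ℝ) = P.real Set.univ := by simp
      _ ≤ _ := measureReal_mono hcover
      _ ≤ _ := (measureReal_union_le _ _).trans (add_le_add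
        ((measureReal_union_le _ _).trans (add_le_add
          ((measureReal_union_le _ _).trans (add_le_add p₀ p₂)) p₁')) le_rfl)
  -- The exceptional events cost `(2 + (m - 1)) * b`, half of the allowed `(4 + 2 * (m - 1)) * b`.
  have hm1 : (1 : ℝ) ≤ m := by exact_mod_cast NeZero.pos m
  nlinarith
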